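/- **Setting.** Let $m\ge 1$ be an integer and let $\mathbb{R}_m$ be the real Clifford algebra with generators $e_1,\dots,e_m$ and relations $e_je_\ell+e_\ell e_j=-2\delta_{j\ell}$. Write $x=x_0+\underline{x}$, $\underline{x}=\sum_{j=1}^m x_je_j$, for the points of $\mathbb{R}^{m+1}$, put $r=|\underline{x}|$, and let $\Delta=\sum_{j=0}^m\partial_{x_j}^2$. Let $\Omega_2\subset\mathbb{C}$ be an intrinsic complex domain, i.e. a nonempty connected open set symmetric with respect to the real axis, and set $\Omega_1=\Omega_2\cap\mathbb{R}$, $\Omega=\{x_0+\underline{x}\in\mathbb{R}^{m+1}:(x_0,|\underline{x}|)\in\Omega_2\}$. * A holomorphic function $f(u+iv)=\alpha(u,v)+i\beta(u,v)$ on $\Omega_2$ is *intrinsic* if $f(\bar z)=\overline{f(z)}$. It induces the function $f(x_0+\underline{x})=\alpha(x_0,r)+\frac{\underline{x}}{r}\beta(x_0,r)$ on $\Omega$ (with value $\alpha(x_0,0)$ at $\underline x=0$). * $\mathcal{A}(\Omega_1)$ is the space of real-valued real analytic functions on $\Omega_1$ that extend holomorphically to $\Omega_2$; equivalently, the restrictions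 to $\Omega_1$ of the intrinsic holomorphic functions on $\Omega_2$. The slice extension map $S$ sends $f_0=\sum_i h_i|_{\Omega_1}c_i\in\mathcal{A}(\Omega_1)\otimes\mathbb{R}_m$ ($h_i$ intrinsic holomorphic, $c_i\in\mathbb{R}_m$) to $S[f_0](x)=\sum_i h_i(x_0+\underline{x})c_i$. * $\mathcal{SM}(\Omega)$ is the module of (left) slice monogenic functions: for every unit vector $\underline w$, $(\partial_u+\underline w\,\partial_v)F(u+v\underline w)=0$. * $\mathcal{AM}(\Omega)$ is the module of axially monogenic functions: real analytic $F:\Omega\to\mathbb{R}_m$ with $\partial_{x_0}F+\sum_{j=1}^m e_j\partial_{x_j}F=0$ of the form $F=A(x_0,r)+\frac{\underline x}{r}B(x_0,r)$, where $A,B:\Omega_2\to\mathbb{R}_m$ are real analytic, $A$ even and $B$ odd in the second variable. * For a real analytic $g:\Omega_1\to\mathbb{R}_m$, $\mathrm{GCK}[g]$ (the generalized CK-extension of $g$ to $\Omega$) is the function in $\mathcal{AM}(\Omega)$ that near $\Omega_1$ is the sum of the convergent series $$\Gamma\!\left(\tfrac m2\right)\sum_{k=0}^\infty\frac{(-1)^k}{k!}\left(\frac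 r2\right)^{2k}\left[\frac{g^{(2k)}(x_0)}{\Gamma(k+\frac m2)}+\frac{\underline x}{2}\,\frac{g^{(2k+1)}(x_0)}{\Gamma(k+\frac m2+1)}\right]$$ $$=\Gamma\!\left(\tfrac m2\right)\left(\tfrac{r\partial_{x_0}}2\right)^{-\frac m2}\left[\tfrac{r\partial_{x_0}}2J_{\frac m2-1}(r\partial_{x_0})+\tfrac{\underline x\partial_{x_0}}2J_{\frac m2}(r\partial_{x_0})\right]g(x_0),$$ whenever such a function exists on $\Omega$. **Theorem 4.2.** Let $m$ be odd, with the convention $(-1)!!=1$, and put $\gamma_m=(-1)^{\frac{m-1}2}\frac{(m-1)!!}{(m-2)!!}$. 1. Let $f=\alpha+i\beta$ be intrinsic holomorphic on $\Omega_2$. For every $x_0\in\Omega_1$ the limit $\left(\frac1r\partial_r\right)^{\frac{m-1}2}[\alpha](x_0,0):=\lim_{r\to0}\left(\frac1r\partial_r\right)^{\frac{m-1}2}[\alpha](x_0,r)$ exists, the function $f(x_0+\underline{x})$ is real analytic on $\Omega$, both generalized CK-extensions below exist on $\Omega$, each is the unique function in $\mathcal{AM}(\Omega)$ with the given restriction to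 $\Omega_1$, and on $\Omega$ $$\Delta^{\frac{m-1}2}\big[f(x_0+\underline x)\big]=(m-1)!!\;\mathrm{GCK}\!\left[\left(\tfrac1r\partial_r\right)^{\frac{m-1}2}[\alpha](x_0,0)\right]=\gamma_m\,\mathrm{GCK}\big[f^{(m-1)}(x_0)\big].$$ 2. For every $f_0\in\mathcal{A}(\Omega_1)\otimes\mathbb{R}_m$: $S[f_0]$ is independent of the representation of $f_0$, real analytic, and in $\mathcal{SM}(\Omega)$; $\Delta^{\frac{m-1}2}S[f_0]\in\mathcal{AM}(\Omega)$; $\gamma_m\partial_{x_0}^{m-1}f_0\in\mathcal{A}(\Omega_1)\otimes\mathbb{R}_m$; its generalized CK-extension exists on $\Omega$ and is the unique function in $\mathcal{AM}(\Omega)$ with this restriction to $\Omega_1$; and on $\Omega$ $$\Delta^{\frac{m-1}2}\,S[f_0]=\mathrm{GCK}\big[\gamma_m\,\partial_{x_0}^{m-1}f_0\big],$$ i.e. the square with top arrow $S$, right arrow $\Delta^{\frac{m-1}2}$, left arrow $\gamma_m\partial_{x_0}^{m-1}$ and bottom arrow $\mathrm{GCK}$ commutes. -/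

import Mathlib

noncomputable section

namespace FueterGCK

/-! ### The real Clifford algebra, paravectors and their vector part -/

/-- The quadratic form `v ↦ -(v₁² + ⋯ + v_m²)` on `ℝ^m`. -/
abbrev negSq (m : ℕ) : QuadraticForm ℝ (Fin m → ℝ) :=
  QuadraticMap.weightedSumSquares ℝ (fun _ : Fin m => (-1 : ℝ))

/-- The real Clifford algebra `ℝ_m`: generators `e_1, …, e_m` and relations
`e_j e_l + e_l e_j = -2 δ_{jl}`. -/
abbrev Cl (m : ℕ) : Type := CliffordAlgebra (negSq m)

/-- A vector `v ∈ ℝ^m` seen as the `1`-vector `∑ v_j e_j` of `ℝ_m`. -/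
def vec {m : ℕ} (v : Fin m → ℝ) : Cl m := CliffordAlgebra.ι (negSq m) v

/-- The generator `e_j`. -/
def gen {m : ℕ} (j : Fin m) : Cl m := vec (Pi.single j 1)

/-- The basis `(e_A)`, indexed by the subsets `A` of `{1, …, m}`, of the vector space `ℝ_m`
(transported from the exterior algebra). -/
def clBasis (m : ℕ) : Module.Basis (Finset (Fin m)) ℝ (Cl m) :=
  letI : Invertible (2 : ℝ) := invertibleOfNonzero two_ne_zero
  (Pi.basisFun ℝ (Fin m)).ExteriorAlgebra.map (CliffordAlgebra.equivExterior (negSq m)).symm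

/-- The coefficients `(a_A)` of an element of `ℝ_m`, as a vector of a Euclidean space. -/
def clCoeff (m : ℕ) : Cl m →ₗ[ℝ] EuclideanSpace ℝ (Finset (Fin m)) :=
  ((clBasis m).equivFun.trans (WithLp.linearEquiv 2 ℝ (Finset (Fin m) → ℝ)).symm).toLinearMap

theorem clCoeff_injective (m : ℕ) : Function.Injective (clCoeff m) :=
  LinearEquiv.injective _

/-- The norm `|a| = (∑_A a_A²)^{1/2}` on `ℝ_m`. Only its topology matters below (differentiation of
`ℝ_m`-valued functions), and on a finite-dimensional space all norms define the same one. -/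
instance instNormedAddCommGroupCl (m : ℕ) : NormedAddCommGroup (Cl m) :=
  NormedAddCommGroup.induced (Cl m) (EuclideanSpace ℝ (Finset (Fin m))) (clCoeff m)
    (clCoeff_injective m)

instance instNormedSpaceCl (m : ℕ) : NormedSpace ℝ (Cl m) :=
  NormedSpace.induced ℝ (Cl m) (EuclideanSpace ℝ (Finset (Fin m))) (clCoeff m)

/-- The space `ℝ^{m+1}` of paravectors `x = x_0 + x_1 e_1 + ⋯ + x_m e_m`, with its Euclidean
structure. -/
abbrev Para (m : ℕ) : Type := EuclideanSpace ℝ (Fin (m + 1))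

/-- The paravector `x_0 + v`. -/
def para {m : ℕ} (x₀ : ℝ) (v : Fin m → ℝ) : Para m :=
  WithLp.toLp 2 (Fin.cons x₀ v : Fin (m + 1) → ℝ)

/-- The vector part `x_1 e_1 + ⋯ + x_m e_m ∈ ℝ_m` of a paravector. -/
def vecPart {m : ℕ} (x : Para m) : Cl m := vec (fun j : Fin m => x j.succ)

/-- The Euclidean norm `r` of the vector part of a paravector. -/
def rad {m : ℕ} (x : Para m) : ℝ := Real.sqrt (∑ j : Fin m, x j.succ ^ 2)

/-! ### Domains and intrinsic holomorphic functions -/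

/-- Intrinsic complex domains: connected open sets, symmetric with respect to the real axis. -/
def IsIntrinsicDomain (D : Set ℂ) : Prop :=
  IsOpen D ∧ IsConnected D ∧ ∀ z ∈ D, (starRingEnd ℂ) z ∈ D

/-- The intersection of `D` with the real line. -/
def realTrace (D : Set ℂ) : Set ℝ := {x₀ | (x₀ : ℂ) ∈ D}

/-- The axially symmetric slice domain `{x_0 + x : (x_0, |x|) ∈ D}` of `ℝ^{m+1}`. -/
def axialDomain (m : ℕ) (D : Set ℂ) : Set (Para m) := {x | (⟨x 0, rad x⟩ : ℂ) ∈ D}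

/-- Holomorphic intrinsic functions on `D`. -/
def IsIntrinsicHol (D : Set ℂ) (f : ℂ → ℂ) : Prop :=
  DifferentiableOn ℂ f D ∧ ∀ z ∈ D, f ((starRingEnd ℂ) z) = (starRingEnd ℂ) (f z)

/-- `α(u, v)`, the real part of `f(u + iv)`. -/
def alphaPart (f : ℂ → ℂ) (u v : ℝ) : ℝ := (f ⟨u, v⟩).re

/-- `β(u, v)`, the imaginary part of `f(u + iv)`. -/
def betaPart (f : ℂ → ℂ) (u v : ℝ) : ℝ := (f ⟨u, v⟩).im

/-! ### Slice monogenic functions and the slice extension -/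

/-- (Left) slice monogenic functions on `Ω`: for each unit vector `w` the function
`(u, v) ↦ F(u + v w)` is differentiable and killed by `∂_u + w ∂_v`. -/
def IsSliceMonogenicOn {m : ℕ} (Ω : Set (Para m)) (F : Para m → Cl m) : Prop :=
  ∀ w : Fin m → ℝ, ∑ j, w j ^ 2 = 1 →
    ∀ z : ℂ, para z.re (z.im • w) ∈ Ω →
      DifferentiableAt ℝ (fun ζ : ℂ => F (para ζ.re (ζ.im • w))) z ∧
      fderiv ℝ (fun ζ : ℂ => F (para ζ.re (ζ.im • w))) z 1
        + vec w * fderiv ℝ (fun ζ : ℂ => F (para ζ.re (ζ.im • w))) z Complex.I = 0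

/-- The extension of `f = α + iβ` to paravectors:
`f(x_0 + x) = α(x_0, |x|) + (x / |x|) β(x_0, |x|)`, with the value `α(x_0, 0)` at `x = 0`. -/
def sliceExtC (m : ℕ) (f : ℂ → ℂ) (x : Para m) : Cl m :=
  algebraMap ℝ (Cl m) (alphaPart f (x 0) (rad x))
    + ((rad x)⁻¹ * betaPart f (x 0) (rad x)) • vecPart x

/-- `g = ∑ h_i|_ℝ c_i` on the real trace of `D`, for intrinsic holomorphic `h_i` on `D`
and `c_i ∈ ℝ_m`. -/
def IsHolRep {m : ℕ} (D : Set ℂ) {n : ℕ} (h : Fin n → ℂ → ℂ) (c : Fin n → Cl m)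
    (g : ℝ → Cl m) : Prop :=
  (∀ i, IsIntrinsicHol D (h i)) ∧
    ∀ x₀ ∈ realTrace D, g x₀ = ∑ i, alphaPart (h i) x₀ 0 • c i

/-- The module `𝒜(Ω₁) ⊗ ℝ_m`, `Ω₁ = D ∩ ℝ`: the `ℝ_m`-valued functions on `Ω₁` whose components
are real analytic functions with a holomorphic extension to `D`. -/
def MemA {m : ℕ} (D : Set ℂ) (g : ℝ → Cl m) : Prop :=
  ∃ (n : ℕ) (h : Fin n → ℂ → ℂ) (c : Fin n → Cl m), IsHolRep D h c g

open Classical in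
/-- The slice extension map `S` on `𝒜(Ω₁) ⊗ ℝ_m`: extend the components holomorphically to `D`,
then apply `sliceExtC` to them. -/
def sliceExt (m : ℕ) (D : Set ℂ) (g : ℝ → Cl m) : Para m → Cl m :=
  if H : MemA D g then
    fun x => ∑ i, sliceExtC m (H.choose_spec.choose i) x * H.choose_spec.choose_spec.choose i
  else 0

/-! ### Axially monogenic functions and the generalized CK-extension -/

/-- (Left) monogenic functions on `Ω`: `C¹` functions with
`∂_{x_0} F + ∑ e_j ∂_{x_j} F = 0` on `Ω`. -/
def IsMonogenicOn {m : ℕ} (Ω : Set (Para m)) (F : Para m → Cl m) : Prop :=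
  ContDiffOn ℝ 1 F Ω ∧
    ∀ x ∈ Ω, fderiv ℝ F x (EuclideanSpace.single 0 1)
      + ∑ j : Fin m, gen j * fderiv ℝ F x (EuclideanSpace.single j.succ 1) = 0

/-- The module `𝒜ℳ(Ω)` of axially monogenic functions on `Ω = axialDomain m D`: real analytic
monogenic functions of the form `A(x_0, |x|) + (x / |x|) B(x_0, |x|)` with `ℝ_m`-valued real
analytic functions `A` (even in the second variable) and `B` (odd in it) on `D`. -/
def IsAxialMonogenic {m : ℕ} (D : Set ℂ) (F : Para m → Cl m) : Prop :=
  AnalyticOnNhd ℝ F (axialDomain m D) ∧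
  IsMonogenicOn (axialDomain m D) F ∧
  ∃ A B : ℂ → Cl m, AnalyticOnNhd ℝ A D ∧ AnalyticOnNhd ℝ B D ∧
    (∀ z ∈ D, A ((starRingEnd ℂ) z) = A z) ∧ (∀ z ∈ D, B ((starRingEnd ℂ) z) = -B z) ∧
    ∀ x ∈ axialDomain m D,
      F x = A ⟨x 0, rad x⟩ + ((rad x)⁻¹ • vecPart x) * B ⟨x 0, rad x⟩

/-- The coefficients of the Bessel function
`J_ν(z) = ∑_k (-1)^k / (k! Γ(k + ν + 1)) (z / 2)^{2k + ν}`. -/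
def besselCoeff (ν : ℝ) (k : ℕ) : ℝ :=
  (-1) ^ k / ((k.factorial : ℝ) * Real.Gamma (k + ν + 1))

/-- The `k`-th term of the series
`Γ(m/2) (|x|∂/2)^{-m/2} [ (|x|∂/2) J_{m/2-1}(|x|∂) + (x∂/2) J_{m/2}(|x|∂) ] g (x_0)`, `∂ = ∂_{x_0}`;
the powers of `|x|∂/2` multiply to `(|x|∂/2)^{2k}` in both summands. -/
def gckTerm {m : ℕ} (g : ℝ → Cl m) (x : Para m) (k : ℕ) : Cl m :=
  (Real.Gamma ((m : ℝ) / 2) * (rad x / 2) ^ (2 * k)) •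
    (besselCoeff ((m : ℝ) / 2 - 1) k • iteratedDeriv (2 * k) g (x 0)
      + besselCoeff ((m : ℝ) / 2) k •
          (((1 / 2 : ℝ) • vecPart x) * iteratedDeriv (2 * k + 1) g (x 0)))

/-- `F` is the generalized CK-extension of `g` to `Ω = axialDomain m D`: it is axially monogenic on
`Ω`, and on a neighbourhood of the real trace of `D` it is the sum of the Bessel series of `g`. -/
def IsGCKExtension {m : ℕ} (D : Set ℂ) (g : ℝ → Cl m) (F : Para m → Cl m) : Prop :=
  IsAxialMonogenic D F ∧
    ∀ x₀ ∈ realTrace D, ∀ᶠ x in nhds (para x₀ 0 : Para m), HasSum (gckTerm g x) (F x)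

open Classical in
/-- The operator `GCK` (with values in functions on `axialDomain m D`). -/
def GCK (m : ℕ) (D : Set ℂ) (g : ℝ → Cl m) : Para m → Cl m :=
  if H : ∃ F : Para m → Cl m, IsGCKExtension D g F then H.choose else 0

/-- `GCK[g]` is defined on `axialDomain m D`, has the values `g` on the real line, and is there the
only axially monogenic function with these values. -/
def GCKWellDefined (m : ℕ) (D : Set ℂ) (g : ℝ → Cl m) : Prop :=
  IsGCKExtension D g (GCK m D g) ∧
  (∀ x₀ ∈ realTrace D, GCK m D g (para x₀ 0) = g x₀) ∧
  ∀ F : Para m → Cl m, IsAxialMonogenic D F → (∀ x₀ ∈ realTrace D, F (para x₀ 0) = g x₀) →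
    Set.EqOn F (GCK m D g) (axialDomain m D)

/-! ### The differential operators -/

/-- The `k`-th power of the Laplace operator of `ℝ^{m+1}`. -/
def laplacePow {m : ℕ} (k : ℕ) (F : Para m → Cl m) : Para m → Cl m :=
  (fun G : Para m → Cl m => Laplacian.laplacian G)^[k] F

/-- `((1/r) ∂_r)^k a`, at `r ≠ 0`. -/
def radialOp (k : ℕ) (a : ℝ → ℝ) : ℝ → ℝ :=
  (fun b : ℝ → ℝ => fun r => r⁻¹ * deriv b r)^[k] a

/-- `((1/r) ∂_r)^k [α] (x_0, 0)`: the value at `r = 0` is the limit for `r → 0`. -/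
def radialAtZero (k : ℕ) (f : ℂ → ℂ) (x₀ : ℝ) : ℝ :=
  Filter.limUnder (nhdsWithin (0 : ℝ) {0}ᶜ) (radialOp k (alphaPart f x₀))

/-- `γ_m = (-1)^{(m-1)/2} (m-1)!! / (m-2)!!` for odd `m`; for `m = 1` the truncated subtraction
gives `0!! = 1`, in accordance with the convention `(-1)!! = 1`. -/
def gammaConst (m : ℕ) : ℝ :=
  (-1) ^ ((m - 1) / 2) * ((Nat.doubleFactorial (m - 1) : ℝ) / (Nat.doubleFactorial (m - 2) : ℝ))

end FueterGCK

end

noncomputable section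

namespace FueterGCK

open Filter Topology

/-! ### Directional derivatives -/

/-! Everything rests on the coordinates `u = x_0`, `s = r²`, in which parity in `r` is built in and
the axis `r = 0` is not singular. An intrinsic holomorphic function is `ψ(u, v²) + i v φ(u, v²)`
with `ψ`, `φ` real analytic across `s = 0`, and the Cauchy–Riemann equations become the case `μ = 1`
of the system `∂_u A = 2 s ∂_s B + μ B`, `∂_u B = -2 ∂_s A` (`exists_vekuaAt_of_intrinsicHol`). The
function `A(x_0, r²) + x B(x_0, r²)` is monogenic as soon as the system holds with `μ = m`
(`monogenic_of_vekuaAt`).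

Two facts connect `μ = 1` with `μ = m`: `∂_s` raises `μ` by 2 (`VekuaAt.dd_ds`), and on solutions
with parameter `μ` the Laplacian acts as `(2m - 2μ) ∂_s` (`laplacian_of_vekuaAt`). For `m = 2n + 1`,
therefore, `n` Laplacians produce an axially monogenic function whose restriction to the real line
is `2^n (2n)!! ∂_s^n ψ(x_0, 0)`. The two right-hand sides of the theorem are two readings of `∂_s^n
ψ(x_0, 0)`: the operator `(1/r) ∂_r` is `2 ∂_s` (`radialOp_eq`), and on the axis `∂_u²` acts on
`∂_s^k ψ` as `-2(1 + 2k) ∂_s`, so that `f^{(2n)} = (-2)^n (2n-1)!! ∂_s^n ψ` there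
(`VekuaAt.iteratedDeriv_axis`). The quotient of the constants is `γ_m` (`gammaConst_mul`).

It remains to see that an axially monogenic function is the Bessel series of its restriction.
Monogenicity yields `AxialSystem`, which expresses every `∂_v`-derivative of `A` and `B` on the axis
as a multiple of `∂_u^k A(u, 0)` (`AxialSystem.iterate_dd_I`); the multiples are the Bessel
coefficients (`axialCoeff_bessel`). Summing the Taylor series in `v` gives the claim near the axis
(`hasSum_gckTerm`), and the identity theorem on slices (`eqOn_axialDomain`) gives uniqueness on all
of `Ω`. Hence `GCK[g]` is identified by exhibiting any axially monogenic function with restriction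
`g` (`gckWellDefined_of_axialMonogenic`). -/

section Directional

variable {V E : Type*} [NormedAddCommGroup V] [NormedSpace ℝ V]
  [NormedAddCommGroup E] [NormedSpace ℝ E]

/-- The derivative of `F` in the direction `e`. -/
def dd (e : V) (F : V → E) (p : V) : E := fderiv ℝ F p e

theorem dd_analyticAt [CompleteSpace E] {F : V → E} {p : V} (h : AnalyticAt ℝ F p) (e : V) :
    AnalyticAt ℝ (dd e F) p := by
  exact (ContinuousLinearMap.analyticAt (ContinuousLinearMap.apply ℝ E e) _).comp h.fderiv

theorem dd_congr {F G : V → E} {p : V} (h : F =ᶠ[𝓝 p] G) (e : V) :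
    dd e F =ᶠ[𝓝 p] dd e G := by
  filter_upwards [h.fderiv (𝕜 := ℝ)] with q hq
  rw [dd, dd, hq]

theorem dd_eqOn {F G : V → E} {U : Set V} (hU : IsOpen U) (h : Set.EqOn F G U) (e : V) :
    Set.EqOn (dd e F) (dd e G) U := fun _ hp =>
  (dd_congr (h.eventuallyEq_of_mem (hU.mem_nhds hp)) e).eq_of_nhds

theorem dd_iterate_analyticAt [CompleteSpace E] {F : V → E} {p : V} (h : AnalyticAt ℝ F p) (e : V)
    (k : ℕ) : AnalyticAt ℝ ((dd e)^[k] F) p := by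
  induction k with
  | zero => exact h
  | succ k ih => rw [Function.iterate_succ_apply']; exact dd_analyticAt ih e

theorem dd_iterate_eqOn {F G : V → E} {U : Set V} (hU : IsOpen U) (h : Set.EqOn F G U) (e : V)
    (k : ℕ) : Set.EqOn ((dd e)^[k] F) ((dd e)^[k] G) U := by
  induction k with
  | zero => exact h
  | succ k ih => simp only [Function.iterate_succ_apply']; exact dd_eqOn hU ih e

theorem dd_comm [CompleteSpace E] {F : V → E} {p : V} (h : AnalyticAt ℝ F p) (e e' : V) :
    dd e (dd e' F) p = dd e' (dd e F) p := by
  have hd : DifferentiableAt ℝ (fderiv ℝ F) p := h.fderiv.differentiableAt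
  have hs : IsSymmSndFDerivAt ℝ F p :=
    h.contDiffAt.isSymmSndFDerivAt_of_omega
  have key : ∀ a b : V, dd a (dd b F) p = fderiv ℝ (fderiv ℝ F) p a b := fun a b => by
    unfold dd
    rw [fderiv_clm_apply hd (differentiableAt_const b)]
    simp
  rw [key, key]
  exact hs.eq e e'

theorem dd_add {F G : V → E} {p : V} (hF : DifferentiableAt ℝ F p) (hG : DifferentiableAt ℝ G p)
    (e : V) : dd e (fun q => F q + G q) p = dd e F p + dd e G p := by
  simp [dd, fderiv_fun_add hF hG]

theorem dd_smul {c : V → ℝ} {G : V → E} {p : V} (hc : DifferentiableAt ℝ c p)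
    (hG : DifferentiableAt ℝ G p) (e : V) :
    dd e (fun q => c q • G q) p = c p • dd e G p + dd e c p • G p := by
  simp [dd, fderiv_fun_smul hc hG]

theorem dd_const_smul (c : ℝ) {G : V → E} {p : V} (hG : DifferentiableAt ℝ G p) (e : V) :
    dd e (fun q => c • G q) p = c • dd e G p := by
  simp [dd, fderiv_fun_const_smul hG]

theorem dd_clm {E' : Type*} [NormedAddCommGroup E'] [NormedSpace ℝ E'] (l : E →L[ℝ] E')
    {G : V → E} {p : V} (hG : DifferentiableAt ℝ G p) (e : V) :
    dd e (fun q => l (G q)) p = l (dd e G p) := by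
  have := (l.hasFDerivAt.comp p hG.hasFDerivAt).fderiv
  simp only [dd]
  erw [this]; rfl

/-- Bridge between nested directional derivatives and the multilinear ones: used for `k = 2` in the
Laplacian and for all `k` in Taylor expansions along a line. -/
theorem iteratedFDeriv_diag [CompleteSpace E] {F : V → E} {p : V} (h : AnalyticAt ℝ F p) (e : V)
    (k : ℕ) : iteratedFDeriv ℝ k F p (fun _ => e) = (dd e)^[k] F p := by
  induction k generalizing p with
  | zero => simp
  | succ k ih =>
    rw [iteratedFDeriv_succ_apply_left, Function.iterate_succ_apply']
    have hev : (fun q => iteratedFDeriv ℝ k F q (fun _ => e)) =ᶠ[𝓝 p] (dd e)^[k] F := by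
      filter_upwards [h.eventually_analyticAt] with q hq using ih hq
    rw [← (dd_congr hev e).eq_of_nhds]
    have hd : DifferentiableAt ℝ (iteratedFDeriv ℝ k F) p := by
      have := (h.contDiffAt (n := (k + 1 : ℕ)))
      exact this.differentiableAt_iteratedFDeriv (by exact_mod_cast Nat.lt_succ_self k)
    have := (hd.hasFDerivAt.continuousMultilinear_apply_const (fun _ : Fin k => e)).fderiv
    rw [dd, this]
    rfl

end Directional

/-! ### The Vekua system in the variables `u`, `s = v²` -/

section Vekua

variable {E : Type*} [NormedAddCommGroup E] [NormedSpace ℝ E]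

/-- The derivative in the first variable. -/
abbrev du (A : ℝ × ℝ → E) : ℝ × ℝ → E := dd ((1, 0) : ℝ × ℝ) A

/-- The derivative in the second variable. -/
abbrev ds (A : ℝ × ℝ → E) : ℝ × ℝ → E := dd ((0, 1) : ℝ × ℝ) A

/-- `A` and `B` are analytic at `p` and solve the Vekua system
`∂_u A = 2 s ∂_s B + μ B`, `∂_u B = -2 ∂_s A` near `p`. -/
def VekuaAt (μ : ℝ) (A B : ℝ × ℝ → E) (p : ℝ × ℝ) : Prop :=
  AnalyticAt ℝ A p ∧ AnalyticAt ℝ B p ∧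
    ∀ᶠ q in 𝓝 p, du A q = (2 * q.2) • ds B q + μ • B q ∧ du B q = (-2 : ℝ) • ds A q

theorem VekuaAt.eventually {μ : ℝ} {A B : ℝ × ℝ → E} [CompleteSpace E] {p : ℝ × ℝ}
    (h : VekuaAt μ A B p) : ∀ᶠ q in 𝓝 p, VekuaAt μ A B q := by
  obtain ⟨hA, hB, he⟩ := h
  filter_upwards [hA.eventually_analyticAt, hB.eventually_analyticAt, he.eventually_nhds]
    with q h1 h2 h3 using ⟨h1, h2, h3⟩

theorem dd_snd_smul {B : ℝ × ℝ → E} {p : ℝ × ℝ} (hB : DifferentiableAt ℝ B p) (e : ℝ × ℝ) :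
    dd e (fun q => (2 * q.2) • B q) p = (2 * p.2) • dd e B p + (2 * e.2) • B p := by
  have hf : HasFDerivAt (fun q : ℝ × ℝ => 2 * q.2)
      ((2 : ℝ) • ContinuousLinearMap.snd ℝ ℝ ℝ) p :=
    hasFDerivAt_snd.const_mul 2
  rw [dd_smul hf.differentiableAt hB]
  congr 2
  rw [dd, hf.fderiv]; simp

/-- The product rule applied to `2 s ∂_s B` leaves an extra `2 ∂_s B`, which raises `μ` by 2; the
second equation has constant coefficients and is preserved. -/
theorem VekuaAt.dd_ds [CompleteSpace E] {μ : ℝ} {A B : ℝ × ℝ → E} {p : ℝ × ℝ}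
    (h : VekuaAt μ A B p) : VekuaAt (μ + 2) (ds A) (ds B) p := by
  refine ⟨dd_analyticAt h.1 _, dd_analyticAt h.2.1 _, ?_⟩
  filter_upwards [h.eventually] with q hq
  obtain ⟨hA, hB, he⟩ := hq
  have hB' := (dd_analyticAt hB (0, 1)).differentiableAt
  constructor
  · rw [du, ds, dd_comm hA]
    have : dd ((1, 0) : ℝ × ℝ) A =ᶠ[𝓝 q] fun q => (2 * q.2) • ds B q + μ • B q :=
      he.mono fun _ h => h.1
    rw [(dd_congr this (0, 1)).eq_of_nhds, dd_add, dd_snd_smul hB', dd_const_smul _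
      hB.differentiableAt]
    · simp only [ds]; module
    · exact (by fun_prop : DifferentiableAt ℝ (fun q : ℝ × ℝ => 2 * q.2) q).smul hB'
    · exact hB.differentiableAt.const_smul μ
  · rw [du, ds, dd_comm hB]
    have : dd ((1, 0) : ℝ × ℝ) B =ᶠ[𝓝 q] fun q => (-2 : ℝ) • ds A q :=
      he.mono fun _ h => h.2
    rw [(dd_congr this (0, 1)).eq_of_nhds, dd_const_smul _
      (dd_analyticAt hA (0, 1)).differentiableAt]

theorem VekuaAt.ds_iterate [CompleteSpace E] {μ : ℝ} {A B : ℝ × ℝ → E} {p : ℝ × ℝ}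
    (h : VekuaAt μ A B p) (k : ℕ) : VekuaAt (μ + 2 * k) (ds^[k] A) (ds^[k] B) p := by
  induction k with
  | zero => simpa using h
  | succ k ih =>
    rw [Function.iterate_succ_apply', Function.iterate_succ_apply']
    convert ih.dd_ds using 1
    push_cast; ring

/-- Elimination of the second `u`-derivatives. The terms `-4 s ∂_s²` are what cancels the
second-order radial part of the Laplacian, and on `s = 0` only the first-order terms survive. -/
theorem VekuaAt.du_du [CompleteSpace E] {μ : ℝ} {A B : ℝ × ℝ → E} {p : ℝ × ℝ}
    (h : VekuaAt μ A B p) :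
    du (du A) p = (-4 * p.2) • ds (ds A) p - (2 * μ) • ds A p ∧
    du (du B) p = (-4 * p.2) • ds (ds B) p - (2 * (μ + 2)) • ds B p := by
  obtain ⟨hA, hB, he⟩ := h
  have hsA := (dd_analyticAt hA (0, 1)).differentiableAt
  have hsB := (dd_analyticAt hB (0, 1)).differentiableAt
  have h2 : du B =ᶠ[𝓝 p] fun q => (-2 : ℝ) • ds A q := he.mono fun _ h => h.2
  have h1 : du A =ᶠ[𝓝 p] fun q => (2 * q.2) • ds B q + μ • B q := he.mono fun _ h => h.1
  have hds : du (ds B) p = (-2 : ℝ) • ds (ds A) p := by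
    rw [du, ds, dd_comm hB, (dd_congr h2 (0, 1)).eq_of_nhds, dd_const_smul _ hsA]
  -- The first equation of the `s`-differentiated system; its parameter `μ + 2` is the one that
  -- appears in the formula for `B`.
  have hds' : du (ds A) p = (2 * p.2) • ds (ds B) p + (μ + 2) • ds B p := by
    exact (VekuaAt.dd_ds ⟨hA, hB, he⟩).2.2.self_of_nhds.1
  constructor
  · rw [du, (dd_congr h1 (1, 0)).eq_of_nhds, dd_add, dd_snd_smul hsB, dd_const_smul _
      hB.differentiableAt]
    · have := h2.self_of_nhds
      simp only [du, ds] at this hds ⊢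
      rw [this, hds]; simp only [mul_zero, zero_smul]; module
    · exact (by fun_prop : DifferentiableAt ℝ (fun q : ℝ × ℝ => 2 * q.2) p).smul hsB
    · exact hB.differentiableAt.const_smul μ
  · rw [du, (dd_congr h2 (1, 0)).eq_of_nhds, dd_const_smul _ hsA]
    simp only [du, ds] at hds' ⊢
    rw [hds']; module

/-- Even derivatives along the axis `s = 0` in terms of the `s`-derivatives. -/
theorem VekuaAt.iteratedDeriv_axis [CompleteSpace E] {A B : ℝ × ℝ → E} {U : Set ℝ}
    (hU : IsOpen U) (h : ∀ u ∈ U, VekuaAt 1 A B (u, 0)) {g : ℝ → E}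
    (hg : ∀ u ∈ U, g u = A (u, 0)) (n : ℕ) :
    ∀ u ∈ U, iteratedDeriv (2 * n) g u =
      ((-2) ^ n * (Nat.doubleFactorial (2 * n - 1) : ℝ)) • ds^[n] A (u, 0) := by
  have line : ∀ G : ℝ × ℝ → E, ∀ u, AnalyticAt ℝ G (u, 0) →
      HasDerivAt (fun t : ℝ => G (t, 0)) (du G (u, 0)) u := fun G u hG => by
    have h1 : HasDerivAt (fun t : ℝ => ((t, 0) : ℝ × ℝ)) (1, 0) u :=
      (hasDerivAt_id u).prodMk (hasDerivAt_const u (0 : ℝ))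
    exact hG.differentiableAt.hasFDerivAt.comp_hasDerivAt u h1
  induction n with
  | zero => intro u hu; simp [hg u hu]
  | succ n ih =>
    intro u hu
    set c : ℝ := (-2) ^ n * (Nat.doubleFactorial (2 * n - 1) : ℝ)
    have hk := fun v hv => (h v hv).ds_iterate n
    have e1 : iteratedDeriv (2 * n + 1) g =ᶠ[𝓝 u] fun t => c • du (ds^[n] A) (t, 0) := by
      filter_upwards [hU.mem_nhds hu] with v hv
      rw [iteratedDeriv_succ]
      have : iteratedDeriv (2 * n) g =ᶠ[𝓝 v] fun t => c • ds^[n] A (t, 0) := by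
        filter_upwards [hU.mem_nhds hv] with w hw using ih w hw
      rw [this.deriv_eq]
      exact ((line _ v (hk v hv).1).const_smul c).deriv
    rw [show 2 * (n + 1) = 2 * n + 1 + 1 by ring, iteratedDeriv_succ, e1.deriv_eq,
      deriv_fun_const_smul c (line _ u (dd_analyticAt (hk u hu).1 _)).differentiableAt,
      (line _ u (dd_analyticAt (hk u hu).1 _)).deriv, (hk u hu).du_du.1,
      Function.iterate_succ_apply']
    -- For `n = 0` the truncated `2 * 0 - 1` is `0`, and `0!! = 1` stands in for `(-1)!!`.
    have hdf : (Nat.doubleFactorial (2 * n + 1 + 1 - 1) : ℝ)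
        = (2 * n + 1) * Nat.doubleFactorial (2 * n - 1) := by
      rcases n with _ | n
      · simp
      · rw [show 2 * (n + 1) + 1 + 1 - 1 = (2 * n + 1) + 2 by omega, Nat.doubleFactorial_add_two]
        push_cast
        rw [show 2 * (n + 1) - 1 = 2 * n + 1 by omega]; ring
    rw [hdf]
    simp only [mul_zero, zero_smul, zero_sub, smul_smul, ← neg_smul]
    congr 1
    simp only [c]; ring

end Vekua

/-! ### Even and odd parts of a holomorphic function as analytic functions of `(u, v²)` -/

/-- The operator `(x, y) ↦ (τ x - (s/ε) y, ε x + τ y)`; its eigenvalues are `τ ± √(-s)`. -/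
def rotOp (ε : ℂ) (p : ℂ × ℂ) : ℂ × ℂ →L[ℂ] ℂ × ℂ :=
  p.1 • ContinuousLinearMap.id ℂ (ℂ × ℂ)
    + (-(p.2 / ε)) • (ContinuousLinearMap.inl ℂ ℂ ℂ).comp (ContinuousLinearMap.snd ℂ ℂ ℂ)
    + ε • (ContinuousLinearMap.inr ℂ ℂ ℂ).comp (ContinuousLinearMap.fst ℂ ℂ ℂ)

theorem rotOp_apply (ε : ℂ) (p z : ℂ × ℂ) :
    rotOp ε p z = (p.1 * z.1 - p.2 / ε * z.2, ε * z.1 + p.1 * z.2) := by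
  ext <;> simp [rotOp] <;> ring

/-- Powers of a 2×2 matrix with eigenvalues `u ± w`, `w² = -s`, where `u = p.1` and `s = p.2`: its
entries are polynomials in `(u, s)`, although the eigenvalues involve a square root. The identities
are multiplied by `2` and `2w`, so that `w = 0` is allowed. -/
theorem rotOp_pow {ε : ℂ} (hε : ε ≠ 0) (p : ℂ × ℂ) {w : ℂ} (hw : w ^ 2 = -p.2) (n : ℕ) :
    2 * ((rotOp ε p ^ n) (1, 0)).1 = (p.1 + w) ^ n + (p.1 - w) ^ n ∧
    2 * w * ((rotOp ε p ^ n) (1, 0)).2 = ε * ((p.1 + w) ^ n - (p.1 - w) ^ n) := by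
  induction n with
  | zero => constructor <;> simp; norm_num
  | succ n ih =>
    obtain ⟨h1, h2⟩ := ih
    have hs : p.2 = -w ^ 2 := by rw [hw]; ring
    rw [pow_succ', mul_apply_eq_comp, rotOp_apply]
    set x := ((rotOp ε p ^ n) (1, 0)).1
    set y := ((rotOp ε p ^ n) (1, 0)).2
    constructor
    · simp only [hs]
      have : 2 * (p.1 * x - -w ^ 2 / ε * y) = p.1 * (2 * x) + w / ε * (2 * w * y) := by ring
      rw [this, h1, h2]; field_simp; ring
    · have : 2 * w * (ε * x + p.1 * y) = ε * w * (2 * x) + p.1 * (2 * w * y) := by ring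
      rw [this, h1, h2]; ring

theorem rotOp_analyticAt (ε c : ℂ) (p : ℂ × ℂ) :
    AnalyticAt ℂ (fun q : ℂ × ℂ => rotOp ε (q.1 - c, q.2)) p := by
  have h (N : ℂ × ℂ →L[ℂ] ℂ × ℂ) (t : ℂ × ℂ → ℂ) (ht : AnalyticAt ℂ t p) :
      AnalyticAt ℂ (fun q => t q • N) p :=
    (ContinuousLinearMap.analyticAt (ContinuousLinearMap.toSpanSingleton ℂ N) _).comp ht
  exact ((h _ _ (analyticAt_fst.sub analyticAt_const)).add
    (h _ _ (analyticAt_snd.div_const).neg)).add analyticAt_const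

/-- Evaluation of an operator at the first basis vector, first coordinate. -/
def evalFst : (ℂ × ℂ →L[ℂ] ℂ × ℂ) →L[ℂ] ℂ :=
  (ContinuousLinearMap.fst ℂ ℂ ℂ).comp (ContinuousLinearMap.apply ℂ (ℂ × ℂ) ((1, 0) : ℂ × ℂ))

/-- Evaluation of an operator at the first basis vector, second coordinate. -/
def evalSnd : (ℂ × ℂ →L[ℂ] ℂ × ℂ) →L[ℂ] ℂ :=
  (ContinuousLinearMap.snd ℂ ℂ ℂ).comp (ContinuousLinearMap.apply ℂ (ℂ × ℂ) ((1, 0) : ℂ × ℂ))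

theorem evalFst_apply (T : ℂ × ℂ →L[ℂ] ℂ × ℂ) : evalFst T = (T (1, 0)).1 := rfl

theorem evalSnd_apply (T : ℂ × ℂ →L[ℂ] ℂ × ℂ) : evalSnd T = (T (1, 0)).2 := rfl

theorem _root_.HasSum.congr_terms {E : Type*} [AddCommMonoid E] [TopologicalSpace E] {a b : ℕ → E}
    {t : E} (h : HasSum a t) (hab : ∀ n, b n = a n) : HasSum b t := by
  rwa [funext hab]

/-- Functional calculus instead of a rearrangement of series: the power series of `f` is evaluated
at an operator that is analytic in `(u, s)` and has eigenvalues `u - c ± w`. The even and odd parts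
are read off from the image of the first basis vector. At `(c, 0)` the operator is nilpotent but not
zero; the factor `ε` shrinks it into the ball of convergence. -/
theorem exists_analytic_even_odd_parts {f : ℂ → ℂ} {c : ℂ} (hf : AnalyticAt ℂ f c) :
    ∃ P Q : ℂ × ℂ → ℂ, AnalyticAt ℂ P (c, 0) ∧ AnalyticAt ℂ Q (c, 0) ∧
      ∀ᶠ p in 𝓝 ((c, 0) : ℂ × ℂ), ∀ w : ℂ, w ^ 2 = -p.2 →
        2 * P p = f (p.1 + w) + f (p.1 - w) ∧ 2 * w * Q p = f (p.1 + w) - f (p.1 - w) := by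
  obtain ⟨ps, r, hps⟩ := hf
  obtain ⟨ρ, hρ0, hρ⟩ := ENNReal.lt_iff_exists_nnreal_btwn.1 hps.r_pos
  have hρ0' : 0 < ρ := by exact_mod_cast hρ0
  have hρr : (ρ : ENNReal) < ps.radius := hρ.trans_le hps.r_le
  set a : ℕ → ℂ := ps.coeff
  set q := FormalMultilinearSeries.ofScalars (ℂ × ℂ →L[ℂ] ℂ × ℂ) a
  have hqr : (ρ : ENNReal) ≤ q.radius := by
    obtain ⟨C, -, hC⟩ := ps.norm_mul_pow_le_of_lt_radius hρr
    refine q.le_radius_of_bound C fun n => ?_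
    have : ‖q n‖ = ‖ps n‖ := by
      rw [FormalMultilinearSeries.ofScalars_norm, ps.norm_apply_eq_norm_coef]
    rw [this]; exact hC n
  have hqpos : 0 < q.radius := hρ0.trans_le hqr
  have hq := q.hasFPowerSeriesOnBall hqpos
  -- a small off-diagonal entry
  obtain ⟨ε, hε0, hε⟩ : ∃ ε : ℂ, ε ≠ 0 ∧ rotOp ε (0, 0) ∈ Metric.eball (0 : ℂ × ℂ →L[ℂ] ℂ × ℂ) ρ := by
    have hc : Continuous fun ε : ℂ => rotOp ε (0, 0) := by unfold rotOp; simp; fun_prop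
    have h0 : rotOp 0 (0, 0) = 0 := by ext <;> simp [rotOp_apply]
    have hm : (fun ε : ℂ => rotOp ε (0, 0)) ⁻¹' Metric.eball 0 ρ ∈ 𝓝 (0 : ℂ) :=
      hc.continuousAt.preimage_mem_nhds (by
        rw [h0]; exact Metric.eball_mem_nhds _ hρ0)
    have : ∀ᶠ ε in 𝓝[≠] (0 : ℂ), rotOp ε (0, 0) ∈ Metric.eball (0 : ℂ × ℂ →L[ℂ] ℂ × ℂ) ρ :=
      nhdsWithin_le_nhds hm
    obtain ⟨ε, h1, h2⟩ := (this.and self_mem_nhdsWithin).exists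
    exact ⟨ε, h2, h1⟩
  set T : ℂ × ℂ → (ℂ × ℂ →L[ℂ] ℂ × ℂ) := fun p => rotOp ε (p.1 - c, p.2) with hT
  have hT0 : T (c, 0) ∈ Metric.eball (0 : ℂ × ℂ →L[ℂ] ℂ × ℂ) ρ := by simpa [hT] using hε
  have hTa : AnalyticAt ℂ T (c, 0) := rotOp_analyticAt ε c _
  have hG : AnalyticAt ℂ (fun p => q.sum (T p)) (c, 0) := by
    have : AnalyticAt ℂ q.sum (T (c, 0)) := hq.analyticAt_of_mem (Metric.eball_subset_eball hqr hT0)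
    exact this.comp hTa
  refine ⟨fun p => evalFst (q.sum (T p)), fun p => evalSnd (q.sum (T p)) / ε,
    (evalFst.analyticAt _).comp hG, ((evalSnd.analyticAt _).comp hG).div_const, ?_⟩
  have e1 : ∀ᶠ p in 𝓝 ((c, 0) : ℂ × ℂ), T p ∈ Metric.eball (0 : ℂ × ℂ →L[ℂ] ℂ × ℂ) ρ :=
    hTa.continuousAt.preimage_mem_nhds (Metric.isOpen_eball.mem_nhds hT0)
  have hρR : (0 : ℝ) < ρ := by exact_mod_cast hρ0'
  have e2 : ∀ᶠ p in 𝓝 ((c, 0) : ℂ × ℂ), ‖p.1 - c‖ < ρ / 2 := by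
    have : ContinuousAt (fun p : ℂ × ℂ => ‖p.1 - c‖) (c, 0) := by fun_prop
    exact this.eventually_lt continuousAt_const (by simpa using half_pos hρR)
  have e3 : ∀ᶠ p in 𝓝 ((c, 0) : ℂ × ℂ), ‖p.2‖ < (ρ / 2) ^ 2 := by
    have : ContinuousAt (fun p : ℂ × ℂ => ‖p.2‖) (c, 0) := by fun_prop
    exact this.eventually_lt continuousAt_const (by simpa using by positivity)
  filter_upwards [e1, e2, e3] with p h1 h2 h3 w hw
  have hwn : ‖w‖ < ρ / 2 := by
    have : ‖w‖ ^ 2 < (ρ / 2 : ℝ) ^ 2 := by rw [← norm_pow, hw, norm_neg]; exact h3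
    exact lt_of_pow_lt_pow_left₀ 2 (by positivity) this
  have hsum : HasSum (fun n => a n • T p ^ n) (q.sum (T p)) := by
    have := hq.hasSum (Metric.eball_subset_eball hqr h1)
    rw [zero_add] at this
    exact this.congr_terms fun n => (FormalMultilinearSeries.ofScalars_apply_eq _ _ _).symm
  have hfs : ∀ y : ℂ, ‖y‖ < ρ → HasSum (fun n => a n * y ^ n) (f (c + y)) := fun y hy => by
    have := hps.hasSum (y := y) (by
      rw [Metric.mem_eball, edist_zero_right]
      refine lt_trans ?_ hρ
      rw [← ofReal_norm, ← ENNReal.ofReal_coe_nnreal]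
      exact (ENNReal.ofReal_lt_ofReal_iff hρR).2 hy)
    refine this.congr_terms fun n => ?_
    rw [ps.apply_eq_pow_smul_coeff, smul_eq_mul, mul_comm]
  have hp := hfs (p.1 - c + w) ((norm_add_le _ _).trans_lt (by linarith))
  have hm := hfs (p.1 - c - w) ((norm_sub_le _ _).trans_lt (by linarith))
  rw [show c + (p.1 - c + w) = p.1 + w by ring] at hp
  rw [show c + (p.1 - c - w) = p.1 - w by ring] at hm
  have hpow := fun n => rotOp_pow hε0 (p.1 - c, p.2) hw n
  constructor
  · have hs1 := evalFst.hasSum hsum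
    refine (hs1.mul_left 2).unique ?_
    refine (hp.add hm).congr_terms fun n => ?_
    have := (hpow n).1
    rw [map_smul, evalFst_apply, smul_eq_mul, ← mul_add, ← this]; ring
  · have hs1 := evalSnd.hasSum hsum
    have := (hs1.mul_left (2 * w / ε))
    rw [show 2 * w * (evalSnd (q.sum (T p)) / ε) = 2 * w / ε * evalSnd (q.sum (T p)) by ring]
    refine this.unique ?_
    refine (hp.sub hm).congr_terms fun n => ?_
    have := (hpow n).2
    rw [map_smul, evalSnd_apply, smul_eq_mul, ← mul_sub]
    have h3 : (p.1 - c + w) ^ n - (p.1 - c - w) ^ n = 2 * w * ((T p ^ n) (1, 0)).2 / ε := by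
      rw [this]; field_simp
    rw [h3]; ring

/-- The square root `i √s` of `-s`. -/
def negRoot (s : ℂ) : ℂ := Complex.I * s ^ (1 / 2 : ℂ)

theorem negRoot_sq (s : ℂ) : negRoot s ^ 2 = -s := by
  have : (s ^ (1 / 2 : ℂ)) ^ 2 = s := by
    simp
  rw [negRoot, mul_pow, this, Complex.I_sq]; ring

theorem negRoot_ofReal_sq (v : ℝ) : negRoot ((v : ℂ) ^ 2) = Complex.I * (|v| : ℝ) := by
  have h1 : ((v : ℂ) ^ 2) = ((v ^ 2 : ℝ) : ℂ) := by push_cast; rfl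
  have h2 : (1 / 2 : ℂ) = ((1 / 2 : ℝ) : ℂ) := by push_cast; rfl
  rw [negRoot, h1, h2, ← Complex.ofReal_cpow (sq_nonneg v), ← Real.sqrt_eq_rpow, Real.sqrt_sq_eq_abs]

/-- The branch cut lies along `s ≤ 0`, hence away from the points `s = v² > 0` where this root is
used. -/
theorem negRoot_analyticAt {s : ℂ} (hs : s ∈ Complex.slitPlane) : AnalyticAt ℂ negRoot s :=
  analyticAt_const.mul (analyticAt_id.cpow analyticAt_const hs)

/-- `(f(u + w) + f(u - w)) / 2` with `w² = -s`, as a function of `(u, s)`. -/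
def evenPart (f : ℂ → ℂ) (p : ℂ × ℂ) : ℂ :=
  (f (p.1 + negRoot p.2) + f (p.1 - negRoot p.2)) / 2

/-- `(f(u + w) - f(u - w)) / (2w)` with `w² = -s`, as a function of `(u, s)`, `s ≠ 0`. -/
def oddQuot (f : ℂ → ℂ) (p : ℂ × ℂ) : ℂ :=
  (f (p.1 + negRoot p.2) - f (p.1 - negRoot p.2)) / (2 * negRoot p.2)

open Classical in
/-- The continuous extension of `oddQuot` to `s = 0`. -/
def oddPart (f : ℂ → ℂ) (p : ℂ × ℂ) : ℂ :=
  if p.2 = 0 then limUnder (𝓝[≠] (0 : ℂ)) (fun s => oddQuot f (p.1, s)) else oddQuot f p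

theorem negRoot_ne_zero {s : ℂ} (hs : s ≠ 0) : negRoot s ≠ 0 := fun h => by
  have := negRoot_sq s
  rw [h] at this
  exact hs (by simpa using this.symm)

/-- The square root is singular at `s = 0`, but the even part and the odd quotient do not see the
choice of root, so they agree with the analytic functions of the operator calculus. -/
theorem evenPart_oddPart_analyticAt_axis {f : ℂ → ℂ} {c : ℂ} (hf : AnalyticAt ℂ f c) :
    AnalyticAt ℂ (evenPart f) (c, 0) ∧ AnalyticAt ℂ (oddPart f) (c, 0) := by
  obtain ⟨P, Q, hP, hQ, he⟩ := exists_analytic_even_odd_parts hf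
  constructor
  · refine hP.congr ?_
    filter_upwards [he] with p hp
    rw [evenPart, ← (hp _ (negRoot_sq p.2)).1]; ring
  · refine hQ.congr ?_
    have key : ∀ᶠ p in 𝓝 ((c, 0) : ℂ × ℂ), p.2 ≠ 0 → oddQuot f p = Q p := by
      filter_upwards [he] with p hp h0
      have := negRoot_ne_zero h0
      rw [oddQuot, ← (hp _ (negRoot_sq p.2)).2]
      field_simp
    filter_upwards [key, key.eventually_nhds, hQ.eventually_analyticAt] with p h1 h2 h3
    by_cases h0 : p.2 = 0
    -- At `s = 0` the value is by definition a limit, and continuity of `Q` identifies it with `Q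
    -- p`.
    · rw [oddPart, if_pos h0]
      refine (Tendsto.limUnder_eq ?_).symm
      have hcont : ContinuousAt (fun s : ℂ => (p.1, s)) 0 := by fun_prop
      have hp : (p.1, (0 : ℂ)) = p := by rw [← h0]
      have hc : Tendsto (fun s : ℂ => (p.1, s)) (𝓝 0) (𝓝 p) := by
        have := hcont.tendsto; rwa [hp] at this
      have h4 : Tendsto (fun s => Q (p.1, s)) (𝓝[≠] 0) (𝓝 (Q p)) :=
        (h3.continuousAt.tendsto.comp hc).mono_left nhdsWithin_le_nhds
      refine h4.congr' ?_
      filter_upwards [nhdsWithin_le_nhds (hc.eventually h2), self_mem_nhdsWithin] with s hs hs0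
      exact (hs hs0).symm
    · rw [oddPart, if_neg h0, h1 h0]

theorem evenPart_oddPart_analyticAt_off_axis {f : ℂ → ℂ} {p : ℂ × ℂ}
    (hp : p.2 ∈ Complex.slitPlane) (h1 : AnalyticAt ℂ f (p.1 + negRoot p.2))
    (h2 : AnalyticAt ℂ f (p.1 - negRoot p.2)) :
    AnalyticAt ℂ (evenPart f) p ∧ AnalyticAt ℂ (oddPart f) p := by
  have hw : AnalyticAt ℂ (fun q : ℂ × ℂ => negRoot q.2) p :=
    (negRoot_analyticAt hp).comp_of_eq analyticAt_snd rfl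
  have hp' : AnalyticAt ℂ (fun q : ℂ × ℂ => f (q.1 + negRoot q.2)) p :=
    h1.comp_of_eq (analyticAt_fst.add hw) rfl
  have hm' : AnalyticAt ℂ (fun q : ℂ × ℂ => f (q.1 - negRoot q.2)) p :=
    h2.comp_of_eq (analyticAt_fst.sub hw) rfl
  have h0 : p.2 ≠ 0 := Complex.slitPlane_ne_zero hp
  refine ⟨(hp'.add hm').div_const, ?_⟩
  have : AnalyticAt ℂ (oddQuot f) p := (hp'.sub hm').div (analyticAt_const.mul hw)
    (mul_ne_zero two_ne_zero (negRoot_ne_zero h0))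
  refine this.congr ?_
  have : ∀ᶠ q : ℂ × ℂ in 𝓝 p, q.2 ≠ 0 := continuousAt_snd.eventually_ne h0
  filter_upwards [this] with q hq
  rw [oddPart, if_neg hq]

theorem mk_abs_mem {D : Set ℂ} (hD : IsIntrinsicDomain D) {z : ℂ} (hz : z ∈ D) :
    (z.re : ℂ) + Complex.I * (|z.im| : ℝ) ∈ D ∧ (z.re : ℂ) - Complex.I * (|z.im| : ℝ) ∈ D := by
  have hz' := hD.2.2 z hz
  have e1 : (z.re : ℂ) + Complex.I * (z.im : ℝ) = z := by
    apply Complex.ext <;> simp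
  have e2 : (z.re : ℂ) - Complex.I * (z.im : ℝ) = (starRingEnd ℂ) z := by
    apply Complex.ext <;> simp
  rcases abs_cases z.im with ⟨h, -⟩ | ⟨h, -⟩ <;> rw [h]
  · rw [e1, e2]; exact ⟨hz, hz'⟩
  · push_cast
    rw [mul_neg, sub_neg_eq_add, ← sub_eq_add_neg, e1, e2]; exact ⟨hz', hz⟩

theorem evenPart_oddPart_analyticAt {D : Set ℂ} (hD : IsIntrinsicDomain D) {f : ℂ → ℂ}
    (hf : IsIntrinsicHol D f) {z : ℂ} (hz : z ∈ D) :
    AnalyticAt ℂ (evenPart f) ((z.re : ℂ), (z.im : ℂ) ^ 2) ∧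
    AnalyticAt ℂ (oddPart f) ((z.re : ℂ), (z.im : ℂ) ^ 2) := by
  have hfa := hf.1.analyticOnNhd hD.1
  by_cases h : z.im = 0
  · have hz' : (z.re : ℂ) = z := by apply Complex.ext <;> simp [h]
    simp only [h]
    simpa using evenPart_oddPart_analyticAt_axis (c := z.re) (by rw [hz']; exact hfa z hz)
  · obtain ⟨h1, h2⟩ := mk_abs_mem hD hz
    apply evenPart_oddPart_analyticAt_off_axis
    · have : (0 : ℝ) < z.im ^ 2 := by positivity
      left
      simpa [← Complex.ofReal_pow] using this
    · rw [negRoot_ofReal_sq]; exact hfa _ h1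
    · rw [negRoot_ofReal_sq]; exact hfa _ h2

/-- Restriction of a holomorphic function of two variables to its real part on the real plane. -/
def realTraceRe (P : ℂ × ℂ → ℂ) (p : ℝ × ℝ) : ℝ := (P ((p.1 : ℂ), (p.2 : ℂ))).re

theorem realTraceRe_analyticAt {P : ℂ × ℂ → ℂ} {p : ℝ × ℝ}
    (h : AnalyticAt ℂ P ((p.1 : ℂ), (p.2 : ℂ))) : AnalyticAt ℝ (realTraceRe P) p := by
  have h1 : AnalyticAt ℝ (fun q : ℝ × ℝ => ((q.1 : ℂ), (q.2 : ℂ))) p :=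
    ((Complex.ofRealCLM.analyticAt _).comp analyticAt_fst).prod
      ((Complex.ofRealCLM.analyticAt _).comp analyticAt_snd)
  have h2 : AnalyticAt ℝ P ((p.1 : ℂ), (p.2 : ℂ)) := h.restrictScalars
  exact (Complex.reCLM.analyticAt _).comp (h2.comp_of_eq h1 rfl)

theorem intrinsicHol_real {D : Set ℂ} {f : ℂ → ℂ} (hf : IsIntrinsicHol D f) {z : ℂ} (hz : z ∈ D)
    (h : z.im = 0) : (f z).im = 0 := by
  have h1 := hf.2 z hz
  have h2 : (starRingEnd ℂ) z = z := Complex.conj_eq_iff_im.2 h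
  rw [h2] at h1
  exact Complex.conj_eq_iff_im.1 h1.symm

theorem realTraceRe_evenPart {D : Set ℂ} {f : ℂ → ℂ}
    (hf : IsIntrinsicHol D f) {z : ℂ} (hz : z ∈ D) :
    (f z).re = realTraceRe (evenPart f) (z.re, z.im ^ 2) ∧
    (f z).im = z.im * realTraceRe (oddPart f) (z.re, z.im ^ 2) := by
  have e1 : (z.re : ℂ) + Complex.I * (z.im : ℝ) = z := by
    apply Complex.ext <;> simp
  have e2 : (z.re : ℂ) - Complex.I * (z.im : ℝ) = (starRingEnd ℂ) z := by
    apply Complex.ext <;> simp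
  have hc := hf.2 z hz
  constructor
  · simp only [realTraceRe, evenPart]
    push_cast
    rw [negRoot_ofReal_sq]
    rcases abs_cases z.im with ⟨h, -⟩ | ⟨h, -⟩ <;> rw [h]
    · rw [e1, e2, hc]; simp
    · push_cast
      rw [mul_neg, sub_neg_eq_add, ← sub_eq_add_neg, e1, e2, hc]; simp
  · by_cases h0 : z.im = 0
    · rw [intrinsicHol_real hf hz h0, h0, zero_mul]
    · simp only [realTraceRe, oddPart]
      have : ((z.im ^ 2 : ℝ) : ℂ) ≠ 0 := by exact_mod_cast pow_ne_zero 2 h0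
      rw [if_neg this, oddQuot]
      push_cast
      rw [negRoot_ofReal_sq]
      have key : ∀ y : ℝ, ((y : ℂ) * (2 * Complex.I) / (2 * (Complex.I * (z.im : ℂ)))).re
          = y / z.im := fun y => by
        have : (y : ℂ) * (2 * Complex.I) / (2 * (Complex.I * (z.im : ℂ)))
            = ((y / z.im : ℝ) : ℂ) := by
          have : (z.im : ℂ) ≠ 0 := by exact_mod_cast h0
          push_cast
          field_simp [Complex.I_ne_zero]
        rw [this, Complex.ofReal_re]
      have e3 : f z - (starRingEnd ℂ) (f z) = ((f z).im : ℂ) * (2 * Complex.I) := by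
        apply Complex.ext <;> simp; ring
      rcases abs_cases z.im with ⟨h, -⟩ | ⟨h, -⟩ <;> rw [h]
      · rw [e1, e2, hc, e3, key]; field_simp
      · push_cast
        rw [mul_neg, sub_neg_eq_add, ← sub_eq_add_neg, e1, e2, hc, ← neg_sub, e3, mul_neg,
          neg_div_neg_eq, key]; field_simp

/-- The derivative of `f` along `1` and along `i` is computed twice, from `deriv f z` and by the
chain rule through `(u, v²)`; the real and imaginary parts are then compared. -/
theorem cauchyRiemann_system {f : ℂ → ℂ} {ψ φ : ℝ × ℝ → ℝ} {z : ℂ}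
    (hf : DifferentiableAt ℂ f z) (h0 : z.im ≠ 0)
    (hψ : DifferentiableAt ℝ ψ (z.re, z.im ^ 2)) (hφ : DifferentiableAt ℝ φ (z.re, z.im ^ 2))
    (he : ∀ᶠ ζ in 𝓝 z, (f ζ).re = ψ (ζ.re, ζ.im ^ 2) ∧ (f ζ).im = ζ.im * φ (ζ.re, ζ.im ^ 2)) :
    du ψ (z.re, z.im ^ 2)
      = (2 * z.im ^ 2) * ds φ (z.re, z.im ^ 2) + φ (z.re, z.im ^ 2) ∧
    du φ (z.re, z.im ^ 2) = -2 * ds ψ (z.re, z.im ^ 2) := by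
  set v := z.im
  -- derivative of `f` along the two axes
  have hline : ∀ e : ℂ, HasDerivAt (fun t : ℝ => f (z + t * e)) (deriv f z * e) 0 := fun e => by
    have h1 : HasDerivAt (fun t : ℝ => z + (t : ℂ) * e) e 0 := by
      have := ((hasDerivAt_id (0 : ℝ)).ofReal_comp.mul_const e).const_add z
      simpa using this
    have h2 : HasDerivAt f (deriv f z) (z + ((0 : ℝ) : ℂ) * e) := by simpa using hf.hasDerivAt
    exact HasDerivAt.comp (0 : ℝ) h2 h1
  have hre : ∀ {g : ℝ → ℂ} {g' : ℂ}, HasDerivAt g g' 0 →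
      HasDerivAt (fun t => (g t).re) g'.re 0 := fun hg =>
    Complex.reCLM.hasFDerivAt.comp_hasDerivAt 0 hg
  have him : ∀ {g : ℝ → ℂ} {g' : ℂ}, HasDerivAt g g' 0 →
      HasDerivAt (fun t => (g t).im) g'.im 0 := fun hg =>
    Complex.imCLM.hasFDerivAt.comp_hasDerivAt 0 hg
  have hev : ∀ e : ℂ, ∀ᶠ t : ℝ in 𝓝 0, (f (z + t * e)).re
      = ψ ((z + t * e).re, (z + t * e).im ^ 2) ∧ (f (z + t * e)).im
      = (z + t * e).im * φ ((z + t * e).re, (z + t * e).im ^ 2) := fun e => by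
    have hc : Tendsto (fun t : ℝ => z + (t : ℂ) * e) (𝓝 0) (𝓝 z) := by
      have : Continuous fun t : ℝ => z + (t : ℂ) * e := by fun_prop
      simpa using this.tendsto 0
    exact hc.eventually he
  -- derivatives along the horizontal line
  have hor : ∀ {G : ℝ × ℝ → ℝ}, DifferentiableAt ℝ G (z.re, v ^ 2) →
      HasDerivAt (fun t : ℝ => G (z.re + t, v ^ 2)) (du G (z.re, v ^ 2)) 0 := fun {G} hG => by
    have h1 : HasDerivAt (fun t : ℝ => ((z.re + t, v ^ 2) : ℝ × ℝ)) (1, 0) 0 :=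
      ((hasDerivAt_id (0 : ℝ)).const_add z.re).prodMk (hasDerivAt_const 0 (v ^ 2))
    have h2 : HasFDerivAt G (fderiv ℝ G (z.re, v ^ 2)) (z.re + 0, v ^ 2) := by
      simpa using hG.hasFDerivAt
    exact h2.comp_hasDerivAt 0 h1
  -- derivatives along the vertical line
  have ver : ∀ {G : ℝ × ℝ → ℝ}, DifferentiableAt ℝ G (z.re, v ^ 2) →
      HasDerivAt (fun t : ℝ => G (z.re, (v + t) ^ 2)) (2 * v * ds G (z.re, v ^ 2)) 0 :=
    fun {G} hG => by
    have h1 : HasDerivAt (fun t : ℝ => ((z.re, (v + t) ^ 2) : ℝ × ℝ)) (0, 2 * v) 0 := by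
      have : HasDerivAt (fun t : ℝ => (v + t) ^ 2) (2 * v) 0 := by
        simpa using ((hasDerivAt_id' (0 : ℝ)).const_add v).fun_pow 2
      exact (hasDerivAt_const 0 z.re).prodMk this
    have h2 : HasFDerivAt G (fderiv ℝ G (z.re, v ^ 2)) (z.re, (v + 0) ^ 2) := by
      simpa using hG.hasFDerivAt
    have h3 := h2.comp_hasDerivAt 0 h1
    have h4 : fderiv ℝ G (z.re, v ^ 2) (0, 2 * v) = 2 * v * ds G (z.re, v ^ 2) := by
      rw [ds, dd, ← smul_eq_mul (2 * v), ← map_smul]; simp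
    rw [h4] at h3
    exact h3
  have a1 : du ψ (z.re, v ^ 2) = (deriv f z * 1).re := by
    refine (hor hψ).unique ((hre (hline 1)).congr_of_eventuallyEq ?_)
    filter_upwards [hev 1] with t ht
    rw [ht.1]; simp [v]
  have a2 : v * du φ (z.re, v ^ 2) = (deriv f z * 1).im := by
    refine ((hor hφ).const_mul v).unique ((him (hline 1)).congr_of_eventuallyEq ?_)
    filter_upwards [hev 1] with t ht
    rw [ht.2]; simp [v]
  have a3 : 2 * v * ds ψ (z.re, v ^ 2) = (deriv f z * Complex.I).re := by
    refine (ver hψ).unique ((hre (hline Complex.I)).congr_of_eventuallyEq ?_)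
    filter_upwards [hev Complex.I] with t ht
    rw [ht.1]; simp [v]
  have a4 : φ (z.re, v ^ 2) + v * (2 * v * ds φ (z.re, v ^ 2)) = (deriv f z * Complex.I).im := by
    have h1 := ((hasDerivAt_id (0 : ℝ)).const_add v).mul (ver hφ)
    simp only [id, add_zero, one_mul] at h1
    refine h1.unique ((him (hline Complex.I)).congr_of_eventuallyEq ?_)
    filter_upwards [hev Complex.I] with t ht
    simp only [Pi.mul_apply]
    rw [ht.2]; simp [v]
  simp at a1 a2 a3 a4
  constructor
  · rw [a1, ← a4]; ring
  -- The comparison only yields `v ∂_u φ = -2 v ∂_s ψ`; this is where `v ≠ 0` is needed.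
  · apply mul_left_cancel₀ h0
    rw [a2]; linarith

/-- An intrinsic holomorphic function, written as `ψ(u, v²) + i v φ(u, v²)`. -/
theorem exists_vekuaAt_of_intrinsicHol {D : Set ℂ} (hD : IsIntrinsicDomain D) {f : ℂ → ℂ}
    (hf : IsIntrinsicHol D f) :
    ∃ ψ φ : ℝ × ℝ → ℝ, ∀ z ∈ D, VekuaAt 1 ψ φ (z.re, z.im ^ 2) ∧
      (f z).re = ψ (z.re, z.im ^ 2) ∧ (f z).im = z.im * φ (z.re, z.im ^ 2) := by
  set ψ := realTraceRe (evenPart f)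
  set φ := realTraceRe (oddPart f)
  have hrep : ∀ z ∈ D, (f z).re = ψ (z.re, z.im ^ 2) ∧ (f z).im = z.im * φ (z.re, z.im ^ 2) :=
    fun z hz => realTraceRe_evenPart hf hz
  have hψ : ∀ z ∈ D, AnalyticAt ℝ ψ (z.re, z.im ^ 2) := fun z hz =>
    realTraceRe_analyticAt (by push_cast; exact (evenPart_oddPart_analyticAt hD hf hz).1)
  have hφ : ∀ z ∈ D, AnalyticAt ℝ φ (z.re, z.im ^ 2) := fun z hz =>
    realTraceRe_analyticAt (by push_cast; exact (evenPart_oddPart_analyticAt hD hf hz).2)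
  refine ⟨ψ, φ, fun z hz => ⟨⟨hψ z hz, hφ z hz, ?_⟩, hrep z hz⟩⟩
  set p : ℝ × ℝ := (z.re, z.im ^ 2)
  have hmem : ∀ᶠ q : ℝ × ℝ in 𝓝 p, (⟨q.1, √q.2⟩ : ℂ) ∈ D := by
    have hc : Continuous fun q : ℝ × ℝ => (⟨q.1, √q.2⟩ : ℂ) := by
      have : (fun q : ℝ × ℝ => (⟨q.1, √q.2⟩ : ℂ)) = fun q => (q.1 : ℂ) + (√q.2 : ℝ) * Complex.I := by
        funext q; apply Complex.ext <;> simp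
      rw [this]; fun_prop
    refine hc.continuousAt.eventually_mem (hD.1.mem_nhds ?_)
    have := (mk_abs_mem hD hz).1
    convert this using 1
    apply Complex.ext <;> simp [p, Real.sqrt_sq_eq_abs]
  obtain ⟨δ, hδ, hball⟩ := Metric.eventually_nhds_iff_ball.1
    (hmem.and ((hψ z hz).eventually_analyticAt.and (hφ z hz).eventually_analyticAt))
  -- Only points with `s > 0` come from points `u + i√s` off the axis, so the Cauchy–Riemann
  -- equations give the system there. The ball may also contain points with `s ≤ 0`, which are
  -- reached below by analytic continuation.
  have hsys : ∀ q ∈ Metric.ball p δ, 0 < q.2 →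
      du ψ q = (2 * q.2) • ds φ q + (1 : ℝ) • φ q ∧ du φ q = (-2 : ℝ) • ds ψ q := by
    intro q hq hq0
    obtain ⟨h1, h2, h3⟩ := hball q hq
    have hq' : ((⟨q.1, √q.2⟩ : ℂ).re, (⟨q.1, √q.2⟩ : ℂ).im ^ 2) = q := by
      simp [Real.sq_sqrt hq0.le]
    have := cauchyRiemann_system (ψ := ψ) (φ := φ) (hf.1.differentiableAt (hD.1.mem_nhds h1))
      (Real.sqrt_pos.2 hq0).ne' (by rw [hq']; exact h2.differentiableAt)
      (by rw [hq']; exact h3.differentiableAt)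
      (by filter_upwards [hD.1.mem_nhds h1] with ζ hζ using hrep ζ hζ)
    rw [hq'] at this
    simp only [Real.sq_sqrt hq0.le] at this
    simpa using this
  -- A point of the ball with `s > 0`, even when `p` lies on the axis: the base point for the
  -- identity theorem.
  have hp1 : ((p.1, p.2 + δ / 2) : ℝ × ℝ) ∈ Metric.ball p δ := by
    rw [Metric.mem_ball, Prod.dist_eq]
    simp [abs_of_pos hδ, hδ]
  have hp2 : 0 < p.2 + δ / 2 := by positivity
  have hev : ∀ᶠ q in 𝓝 ((p.1, p.2 + δ / 2) : ℝ × ℝ), q ∈ Metric.ball p δ ∧ 0 < q.2 :=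
    Filter.Eventually.and (Metric.isOpen_ball.mem_nhds hp1)
      (continuousAt_snd.eventually (lt_mem_nhds hp2))
  have hlin : ∀ q : ℝ × ℝ, AnalyticAt ℝ (fun q : ℝ × ℝ => 2 * q.2) q := fun q =>
    analyticAt_const.mul analyticAt_snd
  have hpre : IsPreconnected (Metric.ball p δ) := (convex_ball p δ).isPreconnected
  have g1 : Set.EqOn (du ψ) (fun q => (2 * q.2) • ds φ q + (1 : ℝ) • φ q) (Metric.ball p δ) := by
    refine AnalyticOnNhd.eqOn_of_preconnected_of_eventuallyEq (𝕜 := ℝ) (fun q hq => ?_)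
      (fun q hq => ?_) hpre hp1 ?_
    · exact dd_analyticAt (hball q hq).2.1 _
    · exact ((hlin q).fun_smul (dd_analyticAt (hball q hq).2.2 _)).add
        (analyticAt_const.fun_smul (hball q hq).2.2)
    · filter_upwards [hev] with q hq using (hsys q hq.1 hq.2).1
  have g2 : Set.EqOn (du φ) (fun q => (-2 : ℝ) • ds ψ q) (Metric.ball p δ) := by
    refine AnalyticOnNhd.eqOn_of_preconnected_of_eventuallyEq (𝕜 := ℝ) (fun q hq => ?_)
      (fun q hq => ?_) hpre hp1 ?_
    · exact dd_analyticAt (hball q hq).2.2 _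
    · exact analyticAt_const.fun_smul (dd_analyticAt (hball q hq).2.1 _)
    · filter_upwards [hev] with q hq using (hsys q hq.1 hq.2).2
  filter_upwards [Metric.ball_mem_nhds p hδ] with q hq using ⟨g1 hq, g2 hq⟩

/-! ### Calculus for functions with values in the Clifford algebra -/

instance instFiniteDimensionalCl (m : ℕ) : FiniteDimensional ℝ (Cl m) :=
  Module.Finite.of_basis (clBasis m)

instance instCompleteSpaceCl (m : ℕ) : CompleteSpace (Cl m) := FiniteDimensional.complete ℝ (Cl m)

/-- The multiplication of `ℝ_m` as a continuous bilinear map. -/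
def mulL (m : ℕ) : Cl m →L[ℝ] Cl m →L[ℝ] Cl m :=
  ((LinearMap.toContinuousLinearMap : (Cl m →ₗ[ℝ] Cl m) ≃ₗ[ℝ] (Cl m →L[ℝ] Cl m)).toLinearMap ∘ₗ
    LinearMap.mul ℝ (Cl m)).toContinuousLinearMap

theorem mulL_apply {m : ℕ} (a b : Cl m) : mulL m a b = a * b := rfl

/-- The `i`-th coordinate as a continuous linear functional. -/
def coordL {m : ℕ} (i : Fin (m + 1)) : Para m →L[ℝ] ℝ := EuclideanSpace.proj i

theorem coordL_apply {m : ℕ} (i : Fin (m + 1)) (x : Para m) : coordL i x = x i := rfl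

/-- `vecPart` as a continuous linear map. -/
def vecL (m : ℕ) : Para m →L[ℝ] Cl m :=
  LinearMap.toContinuousLinearMap ((CliffordAlgebra.ι (negSq m)).comp
    (LinearMap.pi fun j : Fin m => (coordL j.succ).toLinearMap))

theorem vec_mul_vec {m : ℕ} (v : Fin m → ℝ) :
    vec v * vec v = algebraMap ℝ (Cl m) (-∑ j, v j ^ 2) := by
  rw [vec, CliffordAlgebra.ι_sq_scalar]
  congr 1
  rw [QuadraticMap.weightedSumSquares_apply, ← Finset.sum_neg_distrib]
  exact Finset.sum_congr rfl fun j _ => by simp [sq]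

theorem vec_eq_sum {m : ℕ} (v : Fin m → ℝ) : vec v = ∑ j, v j • gen j := by
  have h : v = ∑ j, v j • (Pi.single j 1 : Fin m → ℝ) := by
    ext i; simp [Finset.sum_apply, Pi.single_apply]
  conv_lhs => rw [h]
  simp only [vec, gen, map_sum, map_smul]

theorem gen_mul_gen_self {m : ℕ} (j : Fin m) : gen j * gen j = (-1 : Cl m) := by
  rw [gen, vec_mul_vec]
  simp [Pi.single_apply]

/-- The place where the dimension enters: the Dirac operator applied to the factor `x` yields `-m`,
which becomes the parameter `μ = m` of the monogenic system. -/
theorem sum_gen_mul_gen_mul {m : ℕ} (y : Cl m) :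
    ∑ j : Fin m, gen j * (gen j * y) = (-(m : ℝ)) • y := by
  have : ∀ j : Fin m, gen j * (gen j * y) = -y := fun j => by
    rw [← mul_assoc, gen_mul_gen_self]; simp
  simp only [this]
  rw [Finset.sum_const, Finset.card_univ, Fintype.card_fin, ← Nat.cast_smul_eq_nsmul ℝ]
  simp

theorem sum_smul_gen_mul {m : ℕ} (x : Para m) (y : Cl m) :
    ∑ j : Fin m, x j.succ • (gen j * y) = vecPart x * y := by
  rw [vecPart, vec_eq_sum, Finset.sum_mul]
  simp only [smul_mul_assoc]

/-- The pair `(x_0, |x|²)`. -/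
def axisCoord {m : ℕ} (x : Para m) : ℝ × ℝ := (x 0, ∑ j : Fin m, x j.succ ^ 2)

theorem axisCoord_snd_nonneg {m : ℕ} (x : Para m) : 0 ≤ (axisCoord x).2 := by
  unfold axisCoord; positivity

theorem vecPart_mul_vecPart {m : ℕ} (x : Para m) (y : Cl m) :
    vecPart x * (vecPart x * y) = (-(axisCoord x).2) • y := by
  rw [← mul_assoc, vecPart, vec_mul_vec, ← Algebra.smul_def]; rfl

theorem rad_sq {m : ℕ} (x : Para m) : rad x ^ 2 = (axisCoord x).2 :=
  Real.sq_sqrt (axisCoord_snd_nonneg x)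

theorem coord_analyticAt {m : ℕ} (i : Fin (m + 1)) (x : Para m) :
    AnalyticAt ℝ (fun y : Para m => y i) x :=
  (coordL i).analyticAt x

theorem axisCoord_analyticAt {m : ℕ} (x : Para m) : AnalyticAt ℝ axisCoord x :=
  (coord_analyticAt 0 x).prod
    (Finset.analyticAt_fun_sum _ fun j _ => (coord_analyticAt j.succ x).fun_pow 2)

theorem coord_hasFDerivAt {m : ℕ} (i : Fin (m + 1)) (x : Para m) :
    HasFDerivAt (fun y : Para m => y i)
      (coordL i) x :=
  (coordL i).hasFDerivAt

theorem dd_coord {m : ℕ} (i : Fin (m + 1)) (x e : Para m) :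
    dd e (fun y : Para m => y i) x = e i := by
  rw [dd, (coord_hasFDerivAt i x).fderiv]; rfl

theorem dd_axisCoord {m : ℕ} (x e : Para m) :
    dd e axisCoord x = (e 0, ∑ j : Fin m, 2 * x j.succ * e j.succ) := by
  have h2 : HasFDerivAt (fun y : Para m => ∑ j : Fin m, y j.succ ^ 2)
      (∑ j : Fin m, (2 * x j.succ) •
        (coordL j.succ)) x := by
    refine HasFDerivAt.fun_sum fun j _ => ?_
    simpa using (coord_hasFDerivAt j.succ x).pow 2
  have := ((coord_hasFDerivAt 0 x).prodMk h2).fderiv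
  rw [dd, show (axisCoord : Para m → ℝ × ℝ)
    = fun y => (y 0, ∑ j : Fin m, y j.succ ^ 2) from rfl, this]
  simp only [ContinuousLinearMap.prod_apply, sum_apply, smul_apply,
    coordL_apply, smul_eq_mul]

/-- The unit vector of the coordinate `x_i`. -/
abbrev unitVec {m : ℕ} (i : Fin (m + 1)) : Para m := EuclideanSpace.single i 1

theorem dd_axisCoord_zero {m : ℕ} (x : Para m) : dd (unitVec 0) axisCoord x = (1, 0) := by
  rw [dd_axisCoord]; simp [unitVec, Fin.succ_ne_zero]

theorem dd_axisCoord_succ {m : ℕ} (x : Para m) (j : Fin m) :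
    dd (unitVec j.succ) axisCoord x = (0, 2 * x j.succ) := by
  rw [dd_axisCoord]
  simp [unitVec, (Fin.succ_ne_zero j).symm]

theorem dd_comp_axisCoord {m : ℕ} {E : Type*} [NormedAddCommGroup E] [NormedSpace ℝ E]
    {G : ℝ × ℝ → E} {x : Para m} (hG : DifferentiableAt ℝ G (axisCoord x)) :
    dd (unitVec 0) (fun y => G (axisCoord y)) x = du G (axisCoord x) ∧
    ∀ j : Fin m, dd (unitVec j.succ) (fun y => G (axisCoord y)) x
      = (2 * x j.succ) • ds G (axisCoord x) := by
  have h := (hG.hasFDerivAt.comp x (axisCoord_analyticAt x).differentiableAt.hasFDerivAt).fderiv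
  have key : ∀ e : Para m, dd e (fun y => G (axisCoord y)) x
      = fderiv ℝ G (axisCoord x) (dd e axisCoord x) := fun e => by
    rw [dd, show (fun y => G (axisCoord y)) = G ∘ axisCoord from rfl, h]; rfl
  refine ⟨by rw [key, dd_axisCoord_zero]; rfl, fun j => ?_⟩
  rw [key, dd_axisCoord_succ, ds, dd, ← map_smul]
  simp

theorem vecPart_unitVec_zero {m : ℕ} : vecPart (unitVec 0 : Para m) = 0 := by
  rw [vecPart, vec_eq_sum]; simp [unitVec, Fin.succ_ne_zero]

theorem vecPart_unitVec_succ {m : ℕ} (j : Fin m) : vecPart (unitVec j.succ : Para m) = gen j := by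
  rw [vecPart, gen]
  congr 1
  ext i
  simp [unitVec, Pi.single_apply]

/-- The function `A(x_0, |x|²) + x B(x_0, |x|²)`. -/
def axialFn {m : ℕ} (A B : ℝ × ℝ → Cl m) (x : Para m) : Cl m :=
  A (axisCoord x) + vecPart x * B (axisCoord x)

section AxialFn

variable {m : ℕ} {A B : ℝ × ℝ → Cl m} {x : Para m}

theorem analyticAt_comp_axisCoord {G : ℝ × ℝ → Cl m} (hG : AnalyticAt ℝ G (axisCoord x)) :
    AnalyticAt ℝ (fun y : Para m => G (axisCoord y)) x :=
  hG.comp_of_eq (axisCoord_analyticAt x) rfl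

theorem analyticAt_vecPart_mul {G : Para m → Cl m} (hG : AnalyticAt ℝ G x) :
    AnalyticAt ℝ (fun y => vecPart y * G y) x := by
  exact ((mulL m).analyticAt_bilinear _).comp_of_eq (((vecL m).analyticAt x).prod hG) rfl

theorem axialFn_analyticAt (hA : AnalyticAt ℝ A (axisCoord x)) (hB : AnalyticAt ℝ B (axisCoord x)) :
    AnalyticAt ℝ (axialFn A B) x :=
  (analyticAt_comp_axisCoord hA).add (analyticAt_vecPart_mul (analyticAt_comp_axisCoord hB))

theorem dd_vecPart_mul {G : Para m → Cl m} (hG : DifferentiableAt ℝ G x) (e : Para m) :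
    dd e (fun y => vecPart y * G y) x = vecPart x * dd e G x + vecPart e * G x := by
  have h := ((mulL m).hasFDerivAt_of_bilinear ((vecL m).hasFDerivAt (x := x)) hG.hasFDerivAt).fderiv
  rw [dd, show (fun y => vecPart y * G y) = fun y => mulL m (vecL m y) (G y) from rfl, h]
  rfl

theorem dd_axialFn_zero (hA : DifferentiableAt ℝ A (axisCoord x))
    (hB : DifferentiableAt ℝ B (axisCoord x)) :
    dd (unitVec 0) (axialFn A B) x = axialFn (du A) (du B) x := by
  have hN := (axisCoord_analyticAt x).differentiableAt
  have hA' : DifferentiableAt ℝ (fun y : Para m => A (axisCoord y)) x := hA.comp x hN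
  have hB' : DifferentiableAt ℝ (fun y : Para m => B (axisCoord y)) x := hB.comp x hN
  have hX : DifferentiableAt ℝ (fun y : Para m => vecPart y * B (axisCoord y)) x :=
    ((mulL m).hasFDerivAt_of_bilinear ((vecL m).hasFDerivAt (x := x))
      hB'.hasFDerivAt).differentiableAt
  rw [show (axialFn A B : Para m → Cl m)
    = fun y => A (axisCoord y) + vecPart y * B (axisCoord y) from rfl, dd_add hA' hX,
    dd_vecPart_mul hB', (dd_comp_axisCoord hA).1, (dd_comp_axisCoord hB).1, vecPart_unitVec_zero,
    zero_mul, add_zero]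
  rfl

theorem dd_axialFn_succ (hA : DifferentiableAt ℝ A (axisCoord x))
    (hB : DifferentiableAt ℝ B (axisCoord x)) (j : Fin m) :
    dd (unitVec j.succ) (axialFn A B) x
      = (2 * x j.succ) • axialFn (ds A) (ds B) x + gen j * B (axisCoord x) := by
  have hN := (axisCoord_analyticAt x).differentiableAt
  have hA' : DifferentiableAt ℝ (fun y : Para m => A (axisCoord y)) x := hA.comp x hN
  have hB' : DifferentiableAt ℝ (fun y : Para m => B (axisCoord y)) x := hB.comp x hN
  have hX : DifferentiableAt ℝ (fun y : Para m => vecPart y * B (axisCoord y)) x :=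
    ((mulL m).hasFDerivAt_of_bilinear ((vecL m).hasFDerivAt (x := x))
      hB'.hasFDerivAt).differentiableAt
  rw [show (axialFn A B : Para m → Cl m)
    = fun y => A (axisCoord y) + vecPart y * B (axisCoord y) from rfl, dd_add hA' hX,
    dd_vecPart_mul hB', (dd_comp_axisCoord hA).2, (dd_comp_axisCoord hB).2, vecPart_unitVec_succ]
  simp only [axialFn, smul_add, mul_smul_comm, add_assoc]

/-- The Cauchy–Riemann operator of `ℝ^{m+1}` on functions of axial type. -/
theorem cauchyRiemann_axialFn (hA : DifferentiableAt ℝ A (axisCoord x))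
    (hB : DifferentiableAt ℝ B (axisCoord x)) :
    fderiv ℝ (axialFn A B) x (EuclideanSpace.single 0 1)
      + ∑ j : Fin m, gen j * fderiv ℝ (axialFn A B) x (EuclideanSpace.single j.succ 1)
    = (du A (axisCoord x) - (2 * (axisCoord x).2) • ds B (axisCoord x)
        - (m : ℝ) • B (axisCoord x))
      + vecPart x * (du B (axisCoord x) + (2 : ℝ) • ds A (axisCoord x)) := by
  change dd (unitVec 0) (axialFn A B) x
    + ∑ j : Fin m, gen j * dd (unitVec j.succ) (axialFn A B) x = _
  rw [dd_axialFn_zero hA hB]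
  simp only [dd_axialFn_succ hA hB, mul_add, mul_smul_comm, Finset.sum_add_distrib,
    sum_gen_mul_gen_mul, mul_smul, ← Finset.smul_sum, sum_smul_gen_mul]
  simp only [axialFn, mul_add, vecPart_mul_vecPart]
  module

theorem laplacian_eq_sum_dd {F : Para m → Cl m} (hF : AnalyticAt ℝ F x) :
    Laplacian.laplacian F x = dd (unitVec 0) (dd (unitVec 0) F) x
      + ∑ j : Fin m, dd (unitVec j.succ) (dd (unitVec j.succ) F) x := by
  rw [InnerProductSpace.laplacian_eq_iteratedFDeriv_orthonormalBasis F
    (EuclideanSpace.basisFun (Fin (m + 1)) ℝ), ← Fin.sum_univ_succ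
      (fun i : Fin (m + 1) => dd (unitVec i) (dd (unitVec i) F) x)]
  refine Finset.sum_congr rfl fun i _ => ?_
  have := iteratedFDeriv_diag hF (unitVec i) 2
  simp only [Function.iterate_succ, Function.iterate_zero, Function.comp, id] at this
  rw [← this]
  congr 1
  ext k
  fin_cases k <;> simp [unitVec]

/-- The Laplacian on functions of axial type. -/
theorem laplacian_axialFn (hA : AnalyticAt ℝ A (axisCoord x)) (hB : AnalyticAt ℝ B (axisCoord x)) :
    Laplacian.laplacian (axialFn A B) x
      = axialFn (du (du A)) (du (du B)) x + (4 * (axisCoord x).2) • axialFn (ds (ds A)) (ds (ds B)) x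
        + (2 * m : ℝ) • axialFn (ds A) (ds B) x + (4 : ℝ) • (vecPart x * ds B (axisCoord x)) := by
  have hev : ∀ {G : ℝ × ℝ → Cl m}, AnalyticAt ℝ G (axisCoord x) →
      ∀ᶠ y in 𝓝 x, AnalyticAt ℝ G (axisCoord y) := fun hG =>
    (axisCoord_analyticAt x).continuousAt.eventually hG.eventually_analyticAt
  rw [laplacian_eq_sum_dd (axialFn_analyticAt hA hB)]
  have h0 : dd (unitVec 0) (axialFn A B) =ᶠ[𝓝 x] axialFn (du A) (du B) := by
    filter_upwards [hev hA, hev hB] with y h1 h2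
    exact dd_axialFn_zero h1.differentiableAt h2.differentiableAt
  rw [(dd_congr h0 _).eq_of_nhds, dd_axialFn_zero (dd_analyticAt hA _).differentiableAt
    (dd_analyticAt hB _).differentiableAt]
  -- The coefficient 4 of the mixed term is 2 + 2: one half comes from differentiating `e_j B`, the
  -- other from the factor `x` inside `axialFn (ds A) (ds B)`.
  have hj : ∀ j : Fin m, dd (unitVec j.succ) (dd (unitVec j.succ) (axialFn A B)) x
      = (2 : ℝ) • axialFn (ds A) (ds B) x
        + (4 * x j.succ ^ 2) • axialFn (ds (ds A)) (ds (ds B)) x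
        + (4 : ℝ) • x j.succ • (gen j * ds B (axisCoord x)) := fun j => by
    have h1 : dd (unitVec j.succ) (axialFn A B) =ᶠ[𝓝 x]
        fun y => (2 * y j.succ) • axialFn (ds A) (ds B) y + gen j * B (axisCoord y) := by
      filter_upwards [hev hA, hev hB] with y h1 h2
      exact dd_axialFn_succ h1.differentiableAt h2.differentiableAt j
    have hc : DifferentiableAt ℝ (fun y : Para m => 2 * y j.succ) x :=
      ((coord_analyticAt j.succ x).differentiableAt).const_mul 2
    have hcd : dd (unitVec j.succ) (fun y : Para m => 2 * y j.succ) x = 2 := by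
      have := dd_const_smul 2 (coord_analyticAt j.succ x).differentiableAt (unitVec j.succ)
      simp only [smul_eq_mul, dd_coord] at this
      rw [this]; simp [unitVec]
    have hs := (axialFn_analyticAt (dd_analyticAt hA (0, 1)) (dd_analyticAt hB (0, 1))).differentiableAt
    have hB' := (analyticAt_comp_axisCoord hB).differentiableAt
    have hgB : DifferentiableAt ℝ (fun y => gen j * B (axisCoord y)) x :=
      (mulL m (gen j)).differentiableAt.comp x hB'
    rw [(dd_congr h1 _).eq_of_nhds, dd_add (hc.fun_smul hs) hgB, dd_smul hc hs, hcd]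
    have := dd_clm (mulL m (gen j)) hB' (unitVec j.succ)
    simp only [mulL_apply] at this
    rw [this, (dd_comp_axisCoord hB.differentiableAt).2 j, dd_axialFn_succ
      (dd_analyticAt hA _).differentiableAt (dd_analyticAt hB _).differentiableAt, mul_smul_comm]
    module
  simp only [hj, Finset.sum_add_distrib, Finset.sum_const, Finset.card_univ, Fintype.card_fin,
    ← Finset.smul_sum, ← Finset.sum_smul, sum_smul_gen_mul, ← Finset.mul_sum]
  rw [← Nat.cast_smul_eq_nsmul ℝ]
  simp only [show ∑ j : Fin m, x j.succ ^ 2 = (axisCoord x).2 from rfl]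
  module

theorem monogenic_of_vekuaAt (h : VekuaAt m A B (axisCoord x)) :
    fderiv ℝ (axialFn A B) x (EuclideanSpace.single 0 1)
      + ∑ j : Fin m, gen j * fderiv ℝ (axialFn A B) x (EuclideanSpace.single j.succ 1) = 0 := by
  rw [cauchyRiemann_axialFn h.1.differentiableAt h.2.1.differentiableAt]
  obtain ⟨h1, h2⟩ := h.2.2.self_of_nhds
  rw [h1, h2]
  have : (-2 : ℝ) • ds A (axisCoord x) + (2 : ℝ) • ds A (axisCoord x) = 0 := by module
  rw [this, mul_zero]; module

/-- The terms `±4 s ∂_s²` cancel. In the `B`-part the extra `4 x ∂_s B` compensates the shift of `μ`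
to `μ + 2`, since `2m + 4 - 2(μ + 2) = 2m - 2μ`, so both parts carry the same factor. -/
theorem laplacian_of_vekuaAt {μ : ℝ} (h : VekuaAt μ A B (axisCoord x)) :
    Laplacian.laplacian (axialFn A B) x = (2 * m - 2 * μ) • axialFn (ds A) (ds B) x := by
  rw [laplacian_axialFn h.1 h.2.1]
  obtain ⟨h1, h2⟩ := h.du_du
  simp only [axialFn, h1, h2, mul_sub, mul_smul_comm]
  module

end AxialFn

/-! ### Iterated Laplacians of functions of axial type -/

section VekuaLinear

variable {E E' : Type*} [NormedAddCommGroup E] [NormedSpace ℝ E] [CompleteSpace E]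
  [NormedAddCommGroup E'] [NormedSpace ℝ E'] {μ : ℝ} {p : ℝ × ℝ}

/-- Carries scalar solutions over to Clifford-valued ones, through `t ↦ t • c`. -/
theorem VekuaAt.clm {A B : ℝ × ℝ → E} (h : VekuaAt μ A B p) (l : E →L[ℝ] E') :
    VekuaAt μ (fun q => l (A q)) (fun q => l (B q)) p := by
  refine ⟨(l.analyticAt _).comp h.1, (l.analyticAt _).comp h.2.1, ?_⟩
  filter_upwards [h.eventually] with q hq
  have hA := hq.1.differentiableAt
  have hB := hq.2.1.differentiableAt
  obtain ⟨h1, h2⟩ := hq.2.2.self_of_nhds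
  simp only [du, ds] at h1 h2 ⊢
  rw [dd_clm l hA, dd_clm l hB, dd_clm l hA, dd_clm l hB, h1, h2]
  simp

theorem VekuaAt.add {A B A' B' : ℝ × ℝ → E} (h : VekuaAt μ A B p) (h' : VekuaAt μ A' B' p) :
    VekuaAt μ (fun q => A q + A' q) (fun q => B q + B' q) p := by
  refine ⟨h.1.add h'.1, h.2.1.add h'.2.1, ?_⟩
  filter_upwards [h.eventually, h'.eventually] with q hq hq'
  obtain ⟨h1, h2⟩ := hq.2.2.self_of_nhds
  obtain ⟨h1', h2'⟩ := hq'.2.2.self_of_nhds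
  simp only [du, ds] at h1 h2 h1' h2' ⊢
  rw [dd_add hq.1.differentiableAt hq'.1.differentiableAt,
    dd_add hq.1.differentiableAt hq'.1.differentiableAt,
    dd_add hq.2.1.differentiableAt hq'.2.1.differentiableAt,
    dd_add hq.2.1.differentiableAt hq'.2.1.differentiableAt, h1, h2, h1', h2']
  constructor <;> module

theorem VekuaAt.sum {ι : Type*} (s : Finset ι) {A B : ι → ℝ × ℝ → E}
    (h : ∀ i ∈ s, VekuaAt μ (A i) (B i) p) :
    VekuaAt μ (fun q => ∑ i ∈ s, A i q) (fun q => ∑ i ∈ s, B i q) p := by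
  classical
  induction s using Finset.induction_on with
  | empty =>
    simp only [Finset.sum_empty]
    exact ⟨analyticAt_const, analyticAt_const, by simp [dd]⟩
  | insert i s hi ih =>
    simp only [Finset.sum_insert hi]
    exact (h i (Finset.mem_insert_self _ _)).add
      (ih fun j hj => h j (Finset.mem_insert_of_mem hj))

theorem VekuaAt.const_smul {A B : ℝ × ℝ → E} (h : VekuaAt μ A B p) (c : ℝ) :
    VekuaAt μ (fun q => c • A q) (fun q => c • B q) p :=
  h.clm (c • ContinuousLinearMap.id ℝ E)

end VekuaLinear

theorem axisCoord_eq {m : ℕ} (x : Para m) :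
    axisCoord x = ((⟨x 0, rad x⟩ : ℂ).re, (⟨x 0, rad x⟩ : ℂ).im ^ 2) := by
  rw [← Prod.mk.eta (p := axisCoord x), ← rad_sq]; rfl

theorem continuous_rad {m : ℕ} : Continuous (rad : Para m → ℝ) := by
  unfold rad; fun_prop

theorem continuous_mk_rad {m : ℕ} : Continuous fun x : Para m => (⟨x 0, rad x⟩ : ℂ) := by
  have : (fun x : Para m => (⟨x 0, rad x⟩ : ℂ))
      = fun x => ((x 0 : ℝ) : ℂ) + (rad x : ℝ) * Complex.I := by
    funext q; apply Complex.ext <;> simp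
  have h := continuous_rad (m := m)
  rw [this]; fun_prop

theorem isOpen_axialDomain {m : ℕ} {D : Set ℂ} (hD : IsOpen D) : IsOpen (axialDomain m D) :=
  hD.preimage continuous_mk_rad

theorem vecPart_eq_zero_of_rad {m : ℕ} {x : Para m} (h : rad x = 0) : vecPart x = 0 := by
  have h2 : ∑ j : Fin m, x j.succ ^ 2 = 0 := by
    have := rad_sq x; rw [h] at this; simpa [axisCoord] using this.symm
  rw [Finset.sum_eq_zero_iff_of_nonneg fun _ _ => sq_nonneg _] at h2
  rw [vecPart, vec_eq_sum]
  refine Finset.sum_eq_zero fun j hj => ?_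
  rw [pow_eq_zero_iff two_ne_zero |>.1 (h2 j hj), zero_smul]

section Chain

variable {m : ℕ} {D : Set ℂ} {A B : ℝ × ℝ → Cl m} {F : Para m → Cl m}

theorem vekuaAt_axisCoord {μ : ℝ} (h : ∀ z ∈ D, VekuaAt μ A B (z.re, z.im ^ 2)) {x : Para m}
    (hx : x ∈ axialDomain m D) : VekuaAt μ A B (axisCoord x) := by
  rw [axisCoord_eq]; exact h _ hx

theorem analyticOnNhd_of_vekuaAt (hD : IsOpen D) {μ : ℝ}
    (h : ∀ z ∈ D, VekuaAt μ A B (z.re, z.im ^ 2)) (hF : Set.EqOn F (axialFn A B) (axialDomain m D)) :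
    AnalyticOnNhd ℝ F (axialDomain m D) := fun _ hx =>
  (axialFn_analyticAt (vekuaAt_axisCoord h hx).1 (vekuaAt_axisCoord h hx).2.1).congr
    (hF.eventuallyEq_of_mem ((isOpen_axialDomain hD).mem_nhds hx)).symm

theorem isAxialMonogenic_of_vekuaAt (hD : IsOpen D)
    (h : ∀ z ∈ D, VekuaAt m A B (z.re, z.im ^ 2)) (hF : Set.EqOn F (axialFn A B) (axialDomain m D)) :
    IsAxialMonogenic D F := by
  have han := analyticOnNhd_of_vekuaAt hD h hF
  have hp : ∀ z : ℂ, AnalyticAt ℝ (fun z : ℂ => ((z.re, z.im ^ 2) : ℝ × ℝ)) z := fun z =>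
    (Complex.reCLM.analyticAt z).prod ((Complex.imCLM.analyticAt z).fun_pow 2)
  refine ⟨han, ⟨fun x hx => (han x hx).contDiffAt.contDiffWithinAt, fun x hx => ?_⟩,
    fun z => A (z.re, z.im ^ 2), fun z => z.im • B (z.re, z.im ^ 2),
    fun z hz => (h z hz).1.comp_of_eq (hp z) rfl,
    fun z hz => (Complex.imCLM.analyticAt z).fun_smul ((h z hz).2.1.comp_of_eq (hp z) rfl),
    fun z _ => by simp, fun z _ => by simp, fun x hx => ?_⟩
  · rw [(hF.eventuallyEq_of_mem ((isOpen_axialDomain hD).mem_nhds hx)).fderiv_eq]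
    exact monogenic_of_vekuaAt (vekuaAt_axisCoord h hx)
  · rw [hF hx, axialFn, axisCoord_eq]
    -- On the axis both sides lose their second term, because the vector part vanishes.
    by_cases h0 : rad x = 0
    · rw [vecPart_eq_zero_of_rad h0]; simp
    · rw [smul_mul_assoc, mul_smul_comm, smul_smul, inv_mul_cancel₀ h0, one_smul]

/-- After `k` steps the pair solves the system with parameter `1 + 2k`, so the next Laplacian
contributes the factor `2m - 2(1 + 2k)`. -/
theorem laplacePow_axialFn (hD : IsOpen D) (h : ∀ z ∈ D, VekuaAt 1 A B (z.re, z.im ^ 2))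
    (hF : Set.EqOn F (axialFn A B) (axialDomain m D)) (k : ℕ) :
    Set.EqOn (laplacePow k F) (fun x => (∏ i ∈ Finset.range k, (2 * m - 2 * (1 + 2 * i) : ℝ)) •
      axialFn (ds^[k] A) (ds^[k] B) x) (axialDomain m D) := by
  induction k with
  | zero => intro x hx; simpa [laplacePow] using hF hx
  | succ k ih =>
    intro x hx
    have hv := (vekuaAt_axisCoord h hx).ds_iterate k
    have hL : laplacePow (k + 1) F = Laplacian.laplacian (laplacePow k F) := by
      unfold laplacePow; rw [Function.iterate_succ_apply']
    rw [hL, (InnerProductSpace.laplacian_congr_nhds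
      (ih.eventuallyEq_of_mem ((isOpen_axialDomain hD).mem_nhds hx))).eq_of_nhds]
    have := InnerProductSpace.laplacian_smul (∏ i ∈ Finset.range k, (2 * m - 2 * (1 + 2 * i) : ℝ))
      (axialFn_analyticAt hv.1 hv.2.1).contDiffAt
    erw [this]
    rw [laplacian_of_vekuaAt hv, smul_smul, Finset.prod_range_succ]
    simp only [Function.iterate_succ_apply']

/-- Read in reverse order, the factors are `4(i + 1)`, so the product is `4^n n! = 2^n (2n)!!`. -/
theorem prod_laplace_const (n : ℕ) :
    ∏ i ∈ Finset.range n, (2 * ((2 * n + 1 : ℕ) : ℝ) - 2 * (1 + 2 * i) : ℝ)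
      = 2 ^ n * (Nat.doubleFactorial (2 * n) : ℝ) := by
  rw [Nat.doubleFactorial_two_mul, ← Finset.prod_range_reflect]
  have : ∀ i ∈ Finset.range n, (2 * ((2 * n + 1 : ℕ) : ℝ) - 2 * (1 + 2 * ((n - 1 - i : ℕ) : ℝ)))
      = 4 * ((i + 1 : ℕ) : ℝ) := fun i hi => by
    have hi := Finset.mem_range.1 hi
    have : ((n - 1 - i : ℕ) : ℝ) = n - 1 - i := by
      rw [Nat.cast_sub (by omega), Nat.cast_sub (by omega)]; simp
    rw [this]; push_cast; ring
  rw [Finset.prod_congr rfl this, Finset.prod_mul_distrib, Finset.prod_const, Finset.card_range,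
    ← Nat.cast_prod, Finset.prod_range_add_one_eq_factorial]
  push_cast
  rw [show (4 : ℝ) = 2 * 2 by norm_num, mul_pow]; ring

/-- The Fueter–Sce mapping theorem. -/
theorem laplacePow_fueterSce (hD : IsOpen D) {n : ℕ} (hm : m = 2 * n + 1)
    (h : ∀ z ∈ D, VekuaAt 1 A B (z.re, z.im ^ 2))
    (hF : Set.EqOn F (axialFn A B) (axialDomain m D)) :
    IsAxialMonogenic D (laplacePow n F) ∧
    ∀ x₀ ∈ realTrace D, laplacePow n F (para x₀ 0)
      = (2 ^ n * (Nat.doubleFactorial (2 * n) : ℝ)) • ds^[n] A (x₀, 0) := by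
  have hL := laplacePow_axialFn hD h hF n
  have hc : ∏ i ∈ Finset.range n, (2 * (m : ℝ) - 2 * (1 + 2 * i) : ℝ)
      = 2 ^ n * (Nat.doubleFactorial (2 * n) : ℝ) := by
    rw [hm]; exact prod_laplace_const n
  rw [hc] at hL
  set c : ℝ := 2 ^ n * (Nat.doubleFactorial (2 * n) : ℝ)
  constructor
  · refine isAxialMonogenic_of_vekuaAt (A := fun q => c • ds^[n] A q)
      (B := fun q => c • ds^[n] B q) hD (fun z hz => ?_) fun x hx => ?_
    -- The parameter reached is `1 + 2n = m`, exactly the monogenic one.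
    · convert ((h z hz).ds_iterate n).const_smul c using 1
      rw [hm]; push_cast; ring
    · rw [hL hx]; simp only [axialFn, smul_add, mul_smul_comm]
  · intro x₀ hx₀
    have hr : rad (para x₀ 0 : Para m) = 0 := by simp [rad, para]
    have hx : (para x₀ 0 : Para m) ∈ axialDomain m D := by
      change (⟨x₀, rad (para x₀ 0 : Para m)⟩ : ℂ) ∈ D
      rw [hr]; exact hx₀
    rw [hL hx]
    simp only [axialFn, vecPart_eq_zero_of_rad hr, zero_mul, add_zero]
    rw [axisCoord_eq, hr]
    simp [para]

end Chain

/-! ### Intrinsic domains -/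

section Domains

variable {m : ℕ} {D : Set ℂ}

/-- By symmetry the connected set of imaginary parts contains a number together with its negative,
hence also `0`. -/
theorem realTrace_nonempty (hD : IsIntrinsicDomain D) : (realTrace D).Nonempty := by
  obtain ⟨z, hz⟩ := hD.2.1.nonempty
  have hc : IsPreconnected (Complex.im '' D) :=
    hD.2.1.isPreconnected.image _ Complex.continuous_im.continuousOn
  have h1 : z.im ∈ Complex.im '' D := ⟨z, hz, rfl⟩
  have h2 : -z.im ∈ Complex.im '' D := ⟨_, hD.2.2 z hz, by simp⟩
  have h0 : (0 : ℝ) ∈ Complex.im '' D := by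
    rcases le_total 0 z.im with h | h
    · exact hc.Icc_subset h2 h1 ⟨by linarith, h⟩
    · exact hc.Icc_subset h1 h2 ⟨h, by linarith⟩
  obtain ⟨y, hy, hy0⟩ := h0
  refine ⟨y.re, ?_⟩
  have : ((y.re : ℝ) : ℂ) = y := by apply Complex.ext <;> simp [hy0]
  change ((y.re : ℝ) : ℂ) ∈ D
  rwa [this]

/-- Supplies a base point off the axis, from which identities proved for `v > 0` are continued to
all of `D`. -/
theorem exists_im_pos (hD : IsIntrinsicDomain D) : ∃ z ∈ D, 0 < z.im := by
  obtain ⟨x, hx⟩ := realTrace_nonempty hD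
  have hc : Continuous fun t : ℝ => (x : ℂ) + t * Complex.I := by fun_prop
  have h0 : ∀ᶠ t : ℝ in 𝓝 0, (x : ℂ) + t * Complex.I ∈ D :=
    hc.continuousAt.eventually_mem (hD.1.mem_nhds (by simpa using (show (x : ℂ) ∈ D from hx)))
  have h1 : ∀ᶠ t : ℝ in 𝓝[>] 0, (x : ℂ) + t * Complex.I ∈ D := nhdsWithin_le_nhds h0
  obtain ⟨t, ht, ht0⟩ := (h1.and self_mem_nhdsWithin).exists
  exact ⟨_, ht, by simpa using ht0⟩

theorem isOpen_realTrace (hD : IsOpen D) : IsOpen (realTrace D) :=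
  hD.preimage Complex.continuous_ofReal

theorem rad_para {u v : ℝ} {w : Fin m → ℝ} (hw : ∑ j, w j ^ 2 = 1) :
    rad (para u (v • w)) = |v| := by
  simp only [rad, para, Fin.cons_succ, Pi.smul_apply, smul_eq_mul, mul_pow, ← Finset.mul_sum, hw,
    mul_one]
  exact Real.sqrt_sq_eq_abs v

theorem rad_para_zero (u : ℝ) : rad (para u 0 : Para m) = 0 := by simp [rad, para]

theorem para_apply_zero (u : ℝ) (v : Fin m → ℝ) : (para u v : Para m) 0 = u := rfl

theorem vecPart_para (u : ℝ) (v : Fin m → ℝ) : vecPart (para u v) = vec v := rfl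

theorem para_zero_mem {x₀ : ℝ} (h : x₀ ∈ realTrace D) : (para x₀ 0 : Para m) ∈ axialDomain m D := by
  change (⟨x₀, rad (para x₀ 0 : Para m)⟩ : ℂ) ∈ D
  rw [rad_para_zero]; exact h

theorem mk_abs_mem' (hD : IsIntrinsicDomain D) {z : ℂ} (hz : z ∈ D) : (⟨z.re, |z.im|⟩ : ℂ) ∈ D := by
  convert (mk_abs_mem hD hz).1 using 1
  apply Complex.ext <;> simp

theorem para_mem (hD : IsIntrinsicDomain D) {z : ℂ} (hz : z ∈ D) {w : Fin m → ℝ}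
    (hw : ∑ j, w j ^ 2 = 1) : para z.re (z.im • w) ∈ axialDomain m D := by
  change (⟨z.re, rad (para z.re (z.im • w))⟩ : ℂ) ∈ D
  rw [rad_para hw]; exact mk_abs_mem' hD hz

theorem exists_unit (hm : 0 < m) : ∃ w : Fin m → ℝ, ∑ j, w j ^ 2 = 1 :=
  ⟨Pi.single ⟨0, hm⟩ 1, by simp [Pi.single_apply]⟩

theorem exists_polar (hm : 0 < m) (x : Para m) :
    ∃ w : Fin m → ℝ, ∑ j, w j ^ 2 = 1 ∧ x = para (x 0) (rad x • w) := by
  have hx : x = para (x 0) (fun j => x j.succ) := by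
    ext i; refine Fin.cases ?_ (fun j => ?_) i <;> rfl
  by_cases h : rad x = 0
  · obtain ⟨w, hw⟩ := exists_unit hm
    refine ⟨w, hw, ?_⟩
    have h2 : ∑ j : Fin m, x j.succ ^ 2 = 0 := by
      have := rad_sq x; rw [h] at this; simpa [axisCoord] using this.symm
    rw [Finset.sum_eq_zero_iff_of_nonneg fun _ _ => sq_nonneg _] at h2
    conv_lhs => rw [hx]
    congr 1
    funext j
    simpa [h] using h2 j (Finset.mem_univ _)
  · refine ⟨fun j => (rad x)⁻¹ * x j.succ, ?_, ?_⟩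
    · simp only [mul_pow, ← Finset.mul_sum]
      rw [show ∑ j : Fin m, x j.succ ^ 2 = rad x ^ 2 from (rad_sq x).symm]
      field_simp
    · conv_lhs => rw [hx]
      congr 1
      funext j
      simp [h]

/-- The slice `ζ ↦ Re ζ + (Im ζ) w` as a continuous linear map. -/
def sliceL (w : Fin m → ℝ) : ℂ →L[ℝ] Para m :=
  Complex.reCLM.smulRight (para 1 0) + Complex.imCLM.smulRight (para 0 w)

theorem sliceL_apply (w : Fin m → ℝ) (ζ : ℂ) : sliceL w ζ = para ζ.re (ζ.im • w) := by
  ext i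
  refine Fin.cases ?_ (fun j => ?_) i <;> simp [sliceL, para]

/-- Identity theorem on an axial domain. -/
theorem eqOn_axialDomain (hm : 0 < m) (hD : IsIntrinsicDomain D) {F G : Para m → Cl m}
    (hF : AnalyticOnNhd ℝ F (axialDomain m D)) (hG : AnalyticOnNhd ℝ G (axialDomain m D))
    {x₀ : ℝ} (hx₀ : x₀ ∈ realTrace D) (h : F =ᶠ[𝓝 (para x₀ 0)] G) :
    Set.EqOn F G (axialDomain m D) := by
  intro x hx
  -- The one-variable slice through `x` in the direction `w` is parametrised by the connected set
  -- `D` and meets the real line at `x_0`; the identity theorem on `D` therefore suffices.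
  obtain ⟨w, hw, hxw⟩ := exists_polar hm x
  have han : ∀ {H : Para m → Cl m}, AnalyticOnNhd ℝ H (axialDomain m D) →
      AnalyticOnNhd ℝ (fun ζ : ℂ => H (sliceL w ζ)) D := fun hH ζ hζ =>
    AnalyticAt.comp_of_eq (hH _ (para_mem hD hζ hw)) ((sliceL w).analyticAt ζ) (sliceL_apply w ζ)
  have h0 : sliceL w (x₀ : ℂ) = para x₀ 0 := by rw [sliceL_apply]; simp
  have hev : (fun ζ : ℂ => F (sliceL w ζ)) =ᶠ[𝓝 (x₀ : ℂ)] fun ζ => G (sliceL w ζ) := by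
    have : Tendsto (sliceL w) (𝓝 (x₀ : ℂ)) (𝓝 (para x₀ 0)) := by
      rw [← h0]; exact (sliceL w).continuous.tendsto _
    exact this.eventually h
  have := (han hF).eqOn_of_preconnected_of_eventuallyEq (han hG) hD.2.1.isPreconnected
    (show (x₀ : ℂ) ∈ D from hx₀) hev (show (⟨x 0, rad x⟩ : ℂ) ∈ D from hx)
  simp only [sliceL_apply] at this
  rwa [← hxw] at this

end Domains

/-! ### Axially monogenic functions: the Vekua system and its power series -/

/-- `A` and `B` are analytic on `D` and solve `v (∂_u A - ∂_v B) = (μ - 1) B`,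
`∂_v A = -∂_u B` on `D`, and `B` vanishes on the real axis. -/
structure AxialSystem {E : Type*} [NormedAddCommGroup E] [NormedSpace ℝ E] (μ : ℝ) (D : Set ℂ)
    (A B : ℂ → E) : Prop where
  anA : AnalyticOnNhd ℝ A D
  anB : AnalyticOnNhd ℝ B D
  eq₁ : Set.EqOn (fun z => z.im • (dd 1 A z - dd Complex.I B z)) (fun z => (μ - 1) • B z) D
  eq₂ : Set.EqOn (dd Complex.I A) (fun z => (-1 : ℝ) • dd 1 B z) D
  axis : ∀ x ∈ realTrace D, B (x : ℂ) = 0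

section System

variable {E : Type*} [NormedAddCommGroup E] [NormedSpace ℝ E] {D : Set ℂ}

theorem dd_lin {V : Type*} [NormedAddCommGroup V] [NormedSpace ℝ V] {F G : V → E} {p : V}
    (hF : AnalyticAt ℝ F p) (hG : AnalyticAt ℝ G p) (c d : ℝ) (e : V) :
    dd e (fun q => c • F q + d • G q) p = c • dd e F p + d • dd e G p := by
  rw [dd_add (hF.differentiableAt.fun_const_smul c) (hG.differentiableAt.fun_const_smul d),
    dd_const_smul c hF.differentiableAt, dd_const_smul d hG.differentiableAt]

theorem dd_I_im_smul {G : ℂ → E} {z : ℂ} (hG : AnalyticAt ℝ G z) :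
    dd Complex.I (fun ζ => ζ.im • G ζ) z = z.im • dd Complex.I G z + G z := by
  have h : HasFDerivAt (fun ζ : ℂ => ζ.im) Complex.imCLM z := Complex.imCLM.hasFDerivAt
  rw [dd_smul h.differentiableAt hG.differentiableAt]
  congr 1
  rw [dd, h.fderiv]; simp

theorem dd_one_im_smul {G : ℂ → E} {z : ℂ} (hG : AnalyticAt ℝ G z) :
    dd 1 (fun ζ => ζ.im • G ζ) z = z.im • dd 1 G z := by
  have h : HasFDerivAt (fun ζ : ℂ => ζ.im) Complex.imCLM z := Complex.imCLM.hasFDerivAt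
  rw [dd_smul h.differentiableAt hG.differentiableAt, dd, dd, h.fderiv]; simp

theorem ofReal_line_hasDerivAt {G : ℂ → E} {x : ℝ} (hG : DifferentiableAt ℝ G (x : ℂ)) :
    HasDerivAt (fun t : ℝ => G (t : ℂ)) (dd 1 G (x : ℂ)) x := by
  have h1 : HasDerivAt (fun t : ℝ => (t : ℂ)) 1 x := Complex.ofRealCLM.hasDerivAt
  exact hG.hasFDerivAt.comp_hasDerivAt x h1

variable [CompleteSpace E]

theorem dd_iterate_lin {V : Type*} [NormedAddCommGroup V] [NormedSpace ℝ V] {F G : V → E}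
    {U : Set V} (hU : IsOpen U) (hF : AnalyticOnNhd ℝ F U) (hG : AnalyticOnNhd ℝ G U) (c d : ℝ)
    (e : V) (k : ℕ) : Set.EqOn ((dd e)^[k] (fun q => c • F q + d • G q))
      (fun q => c • (dd e)^[k] F q + d • (dd e)^[k] G q) U := by
  induction k with
  | zero => intro p _; rfl
  | succ k ih =>
    intro p hp
    simp only [Function.iterate_succ_apply']
    rw [dd_eqOn hU ih e hp, dd_lin (dd_iterate_analyticAt (hF p hp) e k)
      (dd_iterate_analyticAt (hG p hp) e k)]

/-- Leibniz rule for a factor linear in `v`. On the axis only the first term remains. -/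
theorem dd_I_iterate_im_smul {G : ℂ → E} (hD : IsOpen D) (hG : AnalyticOnNhd ℝ G D) (k : ℕ) :
    Set.EqOn ((dd Complex.I)^[k + 1] (fun ζ => ζ.im • G ζ))
      (fun z => ((k : ℝ) + 1) • (dd Complex.I)^[k] G z + z.im • (dd Complex.I)^[k + 1] G z) D := by
  induction k with
  | zero =>
    intro z hz
    simp only [zero_add, Function.iterate_one, Function.iterate_zero, id]
    rw [dd_I_im_smul (hG z hz)]; simp [add_comm]
  | succ k ih =>
    intro z hz
    have h1 := dd_iterate_analyticAt (hG z hz) Complex.I k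
    have h2 := dd_iterate_analyticAt (hG z hz) Complex.I (k + 1)
    have him : DifferentiableAt ℝ (fun ζ : ℂ => ζ.im) z := Complex.imCLM.differentiableAt
    rw [Function.iterate_succ_apply', dd_eqOn hD ih _ hz,
      dd_add (h1.differentiableAt.fun_const_smul _) (him.fun_smul h2.differentiableAt),
      dd_I_im_smul h2, dd_const_smul _ h1.differentiableAt,
      ← Function.iterate_succ_apply' (dd Complex.I) (k + 1),
      ← Function.iterate_succ_apply' (dd Complex.I) k]
    push_cast
    module

theorem iteratedDeriv_ofReal {G : ℂ → E} (hD : IsOpen D) (hG : AnalyticOnNhd ℝ G D) {g : ℝ → E}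
    (hg : ∀ x ∈ realTrace D, g x = G x) (k : ℕ) :
    ∀ x ∈ realTrace D, iteratedDeriv k g x = (dd 1)^[k] G (x : ℂ) := by
  induction k with
  | zero => intro x hx; simpa using hg x hx
  | succ k ih =>
    intro x hx
    rw [iteratedDeriv_succ, Function.iterate_succ_apply']
    have : iteratedDeriv k g =ᶠ[𝓝 x] fun t : ℝ => (dd 1)^[k] G (t : ℂ) := by
      filter_upwards [(isOpen_realTrace hD).mem_nhds hx] with y hy using ih y hy
    rw [this.deriv_eq]
    exact (ofReal_line_hasDerivAt (dd_iterate_analyticAt (hG _ hx) 1 k).differentiableAt).deriv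

/-- The coefficients of the system do not depend on `u`, so `∂_u` preserves it. This lets the
recursion for the Taylor coefficients pass from `(A, B)` to `(∂_u A, ∂_u B)`. -/
theorem AxialSystem.dd_one {μ : ℝ} {A B : ℂ → E} (hD : IsOpen D) (h : AxialSystem μ D A B) :
    AxialSystem μ D (dd 1 A) (dd 1 B) := by
  have hA1 : AnalyticOnNhd ℝ (dd 1 A) D := fun z hz => dd_analyticAt (h.anA z hz) _
  have hBI : AnalyticOnNhd ℝ (dd Complex.I B) D := fun z hz => dd_analyticAt (h.anB z hz) _
  have hB1 : AnalyticOnNhd ℝ (dd 1 B) D := fun z hz => dd_analyticAt (h.anB z hz) _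
  refine ⟨hA1, hB1, fun z hz => ?_, fun z hz => ?_, fun x hx => ?_⟩
  · have := dd_eqOn hD h.eq₁ 1 hz
    rw [dd_one_im_smul ((hA1 z hz).fun_sub (hBI z hz)), dd_const_smul _ (h.anB z hz).differentiableAt]
      at this
    have e : dd 1 (fun ζ => dd 1 A ζ - dd Complex.I B ζ) z
        = dd 1 (dd 1 A) z - dd Complex.I (dd 1 B) z := by
      have := dd_lin (hA1 z hz) (hBI z hz) 1 (-1) 1
      simp only [one_smul, neg_smul, ← sub_eq_add_neg] at this
      rw [this, dd_comm (h.anB z hz) 1 Complex.I]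
    simp only
    rw [← this, ← e]
  · have := dd_eqOn hD h.eq₂ 1 hz
    rw [dd_comm (h.anA z hz), dd_const_smul _ (hB1 z hz).differentiableAt] at this
    exact this
  · have h1 := ofReal_line_hasDerivAt (h.anB (x : ℂ) hx).differentiableAt
    have h2 : (fun t : ℝ => B (t : ℂ)) =ᶠ[𝓝 x] fun _ => 0 := by
      filter_upwards [(isOpen_realTrace hD).mem_nhds hx] with y hy using h.axis y hy
    exact h1.unique ((hasDerivAt_const x (0 : E)).congr_of_eventuallyEq h2)

/-- The Taylor coefficients in `v` of the solutions of the system, relative to `∂_u^k A(u, 0)`. -/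
def axialCoeff (μ : ℝ) : ℕ → ℝ × ℝ
  | 0 => (1, 0)
  | k + 1 => (-(axialCoeff μ k).2 / (k + 1), (axialCoeff μ k).1 / (k + μ))

/-- The induction runs over all solutions at once and is applied to `(∂_u A, ∂_u B)`. For `A` one
has `∂_v^{k+1} A = -∂_v^k ∂_u B`. For `B`, the operator `∂_v^{k+1}` applied to the first equation
gives at `v = 0` the relation `(k+1) ∂_v^k (∂_u A - ∂_v B) = (μ-1) ∂_v^{k+1} B`. -/
theorem AxialSystem.iterate_dd_I {μ : ℝ} (hμ : 0 < μ) (hD : IsOpen D) (k : ℕ) :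
    ∀ {A B : ℂ → E}, AxialSystem μ D A B → ∀ x ∈ realTrace D,
      (dd Complex.I)^[k] A (x : ℂ)
        = ((k.factorial : ℝ) * (axialCoeff μ k).1) • (dd 1)^[k] A (x : ℂ) ∧
      (dd Complex.I)^[k] B (x : ℂ)
        = ((k.factorial : ℝ) * (axialCoeff μ k).2) • (dd 1)^[k] A (x : ℂ) := by
  induction k with
  | zero => intro A B h x hx; simp [axialCoeff, h.axis x hx]
  | succ k ih =>
    intro A B h x hx
    have hk1 : (k : ℝ) + 1 ≠ 0 := by positivity
    have hkμ : (k : ℝ) + μ ≠ 0 := by positivity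
    obtain ⟨i1, i2⟩ := ih (h.dd_one hD) x hx
    have hA1 : AnalyticOnNhd ℝ (dd 1 A) D := fun z hz => dd_analyticAt (h.anA z hz) _
    have hBI : AnalyticOnNhd ℝ (dd Complex.I B) D := fun z hz => dd_analyticAt (h.anB z hz) _
    have hB1 : AnalyticOnNhd ℝ (dd 1 B) D := fun z hz => dd_analyticAt (h.anB z hz) _
    have hfac : ((k + 1).factorial : ℝ) = (k + 1) * k.factorial := by
      rw [Nat.factorial_succ]; push_cast; ring
    constructor
    · rw [Function.iterate_succ_apply, dd_iterate_eqOn hD h.eq₂ Complex.I k hx]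
      have := dd_iterate_lin hD hB1 hB1 (-1) 0 Complex.I k hx
      simp only [zero_smul, add_zero] at this
      rw [this, i2, Function.iterate_succ_apply, smul_smul]
      congr 1
      rw [axialCoeff, hfac]
      field_simp
    · have e1 := dd_iterate_eqOn hD h.eq₁ Complex.I (k + 1) hx
      have hG : AnalyticOnNhd ℝ (fun z => dd 1 A z - dd Complex.I B z) D := fun z hz =>
        (hA1 z hz).sub (hBI z hz)
      rw [dd_I_iterate_im_smul hD hG k hx] at e1
      beta_reduce at e1
      have e2 := dd_iterate_lin hD h.anB h.anB (μ - 1) 0 Complex.I (k + 1) hx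
      simp only [zero_smul, add_zero] at e2
      have e3 := dd_iterate_lin hD hA1 hBI 1 (-1) Complex.I k hx
      simp only [one_smul, neg_smul, ← sub_eq_add_neg] at e3
      have hY : (dd Complex.I)^[k] (dd Complex.I B) (x : ℂ) = (dd Complex.I)^[k + 1] B (x : ℂ) :=
        (Function.iterate_succ_apply _ _ _).symm ▸ rfl
      rw [e2, e3, i1, hY] at e1
      simp only [Complex.ofReal_im, zero_smul, add_zero] at e1
      set Y := (dd Complex.I)^[k + 1] B (x : ℂ)
      -- Collecting the terms in `Y` gives `(k + 1) + (μ - 1) = k + μ`, which is nonzero because `μ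
      -- > 0`. Thus the first equation, singular on the axis, still determines `B`.
      have e4 : ((k : ℝ) + μ) • Y
          = (((k : ℝ) + 1) * (k.factorial * (axialCoeff μ k).1)) • (dd 1)^[k] (dd 1 A) (x : ℂ) := by
        have : ((k : ℝ) + μ) • Y = ((k : ℝ) + 1) • Y + (μ - 1) • Y := by module
        rw [this, ← e1]; module
      rw [Function.iterate_succ_apply, axialCoeff, hfac]
      have e5 : Y = ((k : ℝ) + μ)⁻¹ • (((k : ℝ) + μ) • Y) := by
        rw [smul_smul, inv_mul_cancel₀ hkμ, one_smul]
      rw [e5, e4, smul_smul]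
      congr 1
      field_simp

theorem axialCoeff_parity (μ : ℝ) (k : ℕ) :
    (axialCoeff μ (2 * k)).2 = 0 ∧ (axialCoeff μ (2 * k + 1)).1 = 0 := by
  induction k with
  | zero => simp [axialCoeff]
  | succ k ih =>
    have h : (axialCoeff μ (2 * (k + 1))).2 = 0 := by
      rw [show 2 * (k + 1) = (2 * k + 1) + 1 by ring, axialCoeff, ih.2, zero_div]
    exact ⟨h, by rw [axialCoeff, h]; simp⟩

/-- Two steps of the recursion multiply the even coefficient by `-1 / ((2k+2)(2k+μ))`, that is by
`-1 / (4 (k+1)(k+μ/2))`; by `Γ(t+1) = t Γ(t)` this is the ratio of consecutive Bessel terms. -/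
theorem axialCoeff_bessel {μ : ℝ} (hμ : 0 < μ) (k : ℕ) :
    (axialCoeff μ (2 * k)).1 = Real.Gamma (μ / 2) / 2 ^ (2 * k) * besselCoeff (μ / 2 - 1) k ∧
    (axialCoeff μ (2 * k + 1)).2
      = Real.Gamma (μ / 2) / 2 ^ (2 * k) * besselCoeff (μ / 2) k * (1 / 2) := by
  have hG : ∀ j : ℕ, Real.Gamma ((j : ℝ) + μ / 2) ≠ 0 := fun j =>
    (Real.Gamma_pos_of_pos (by positivity)).ne'
  have hG' : ∀ j : ℕ, Real.Gamma ((j : ℝ) + μ / 2 + 1)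
      = ((j : ℝ) + μ / 2) * Real.Gamma ((j : ℝ) + μ / 2) := fun j =>
    Real.Gamma_add_one (by positivity)
  have step : ∀ j : ℕ,
      (axialCoeff μ (2 * j)).1 = Real.Gamma (μ / 2) / 2 ^ (2 * j) * besselCoeff (μ / 2 - 1) j →
      (axialCoeff μ (2 * j + 1)).2
        = Real.Gamma (μ / 2) / 2 ^ (2 * j) * besselCoeff (μ / 2) j * (1 / 2) := fun j hj => by
    have hp : (j : ℝ) + μ / 2 ≠ 0 := by positivity
    have hp' : ((2 * j : ℕ) : ℝ) + μ ≠ 0 := by positivity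
    have := hG j
    rw [axialCoeff, hj, besselCoeff, besselCoeff, hG',
      show (j : ℝ) + (μ / 2 - 1) + 1 = j + μ / 2 by ring]
    push_cast at hp' ⊢
    field_simp
  induction k with
  | zero =>
    have h0 : (axialCoeff μ (2 * 0)).1
        = Real.Gamma (μ / 2) / 2 ^ (2 * 0) * besselCoeff (μ / 2 - 1) 0 := by
      have := hG 0
      simp only [Nat.cast_zero, zero_add] at this
      simp [axialCoeff, besselCoeff, this]
    exact ⟨h0, step 0 h0⟩
  | succ k ih =>
    have h1 : (axialCoeff μ (2 * (k + 1))).1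
        = Real.Gamma (μ / 2) / 2 ^ (2 * (k + 1)) * besselCoeff (μ / 2 - 1) (k + 1) := by
      rw [show 2 * (k + 1) = (2 * k + 1) + 1 by ring, axialCoeff, ih.2, besselCoeff, besselCoeff,
        show ((k + 1 : ℕ) : ℝ) + (μ / 2 - 1) + 1 = k + μ / 2 + 1 by push_cast; ring,
        Nat.factorial_succ]
      have := hG (k + 1)
      have hne : Real.Gamma ((k : ℝ) + μ / 2 + 1) ≠ 0 := by
        rw [show (k : ℝ) + μ / 2 + 1 = ((k + 1 : ℕ) : ℝ) + μ / 2 by push_cast; ring]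
        exact this
      have hk1 : (k : ℝ) + 1 ≠ 0 := by positivity
      push_cast
      rw [pow_succ (2 : ℝ) (2 * k + 1), pow_succ (2 : ℝ) (2 * k), pow_succ (-1 : ℝ) k]
      field_simp
      ring
    exact ⟨h1, step (k + 1) h1⟩

/-- Taylor expansion in the imaginary direction, locally uniform in the real part. -/
theorem exists_hasSum_vertical {G : ℂ → E} {x₀ : ℝ} (hG : AnalyticAt ℝ G (x₀ : ℂ)) :
    ∃ ρ : ℝ, 0 < ρ ∧ ∀ u v : ℝ, |u - x₀| < ρ → |v| < ρ →
      HasSum (fun k : ℕ => ((k.factorial : ℝ)⁻¹ * v ^ k) • (dd Complex.I)^[k] G (u : ℂ))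
        (G ⟨u, v⟩) := by
  obtain ⟨p, r, hp⟩ := hG
  obtain ⟨R, hR0, hR⟩ := ENNReal.lt_iff_exists_nnreal_btwn.1 hp.r_pos
  have hR0' : (0 : ℝ) < R := by exact_mod_cast hR0
  -- Half of the radius pays for moving the centre from `x₀` to `u`, the other half for the vertical
  -- displacement `v`.
  refine ⟨R / 2, by positivity, fun u v hu hv => ?_⟩
  set y : ℂ := ((u - x₀ : ℝ) : ℂ)
  have hy : ‖y‖ₑ < ENNReal.ofReal (R / 2) := by
    rw [← ofReal_norm, ENNReal.ofReal_lt_ofReal_iff (by positivity)]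
    simpa [y, ← Complex.ofReal_sub] using hu
  have hvI : ‖v • Complex.I‖ₑ < ENNReal.ofReal (R / 2) := by
    rw [← ofReal_norm, ENNReal.ofReal_lt_ofReal_iff (by positivity)]
    simpa [norm_smul] using hv
  have hRR : ENNReal.ofReal (R / 2) + ENNReal.ofReal (R / 2) = R := by
    rw [← ENNReal.ofReal_add (by positivity) (by positivity), add_halves, ENNReal.ofReal_coe_nnreal]
  have hyr : ‖y‖ₑ < r := by
    refine (hy.trans_le ?_).trans hR
    rw [← hRR]; exact le_self_add
  have hc := hp.changeOrigin hyr
  have hpt : (x₀ : ℂ) + y = (u : ℂ) := by simp [y]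
  rw [hpt] at hc
  have hmem : v • Complex.I ∈ Metric.eball (0 : ℂ) (r - ‖y‖ₑ) := by
    rw [Metric.mem_eball, edist_zero_right]
    refine lt_tsub_iff_right.2 (lt_trans ?_ hR)
    rw [← hRR]
    exact ENNReal.add_lt_add hvI hy
  have hs := hc.hasSum_iteratedFDeriv hmem
  have hz : (u : ℂ) + v • Complex.I = ⟨u, v⟩ := by apply Complex.ext <;> simp
  rw [hz] at hs
  refine hs.congr_terms fun k => ?_
  have hu' : AnalyticAt ℝ G (u : ℂ) := hc.analyticAt
  have := (iteratedFDeriv ℝ k G (u : ℂ)).map_smul_univ (fun _ => v) (fun _ => Complex.I)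
  rw [this, iteratedFDeriv_diag hu', smul_smul]
  simp

end System

/-! ### Axially monogenic functions are generalized CK-extensions -/

section GCKExtension

variable {m : ℕ} {D : Set ℂ}

/-- The point `u + i √s`. -/
def sqrtPt (q : ℝ × ℝ) : ℂ := ⟨q.1, √q.2⟩

theorem sqrtPt_hasFDerivAt {p : ℝ × ℝ} (hp : 0 < p.2) :
    HasFDerivAt sqrtPt (Complex.equivRealProdCLM.symm.toContinuousLinearMap.comp
      ((ContinuousLinearMap.fst ℝ ℝ ℝ).prod
        ((1 / (2 * √p.2)) • ContinuousLinearMap.snd ℝ ℝ ℝ))) p := by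
  have h1 : HasFDerivAt (fun q : ℝ × ℝ => √q.2)
      ((1 / (2 * √p.2)) • ContinuousLinearMap.snd ℝ ℝ ℝ) p :=
    (Real.hasDerivAt_sqrt hp.ne').comp_hasFDerivAt p hasFDerivAt_snd
  exact Complex.equivRealProdCLM.symm.toContinuousLinearMap.hasFDerivAt.comp p
    (hasFDerivAt_fst.prodMk h1)

theorem dd_comp_sqrtPt {E : Type*} [NormedAddCommGroup E] [NormedSpace ℝ E] {G : ℂ → E}
    {p : ℝ × ℝ} (hp : 0 < p.2) (hG : DifferentiableAt ℝ G (sqrtPt p)) :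
    DifferentiableAt ℝ (fun q => G (sqrtPt q)) p ∧
    du (fun q => G (sqrtPt q)) p = dd 1 G (sqrtPt p) ∧
    ds (fun q => G (sqrtPt q)) p = (1 / (2 * √p.2)) • dd Complex.I G (sqrtPt p) := by
  have h := hG.hasFDerivAt.comp p (sqrtPt_hasFDerivAt hp)
  have h' : HasFDerivAt (fun q => G (sqrtPt q)) _ p := h
  refine ⟨h'.differentiableAt, ?_, ?_⟩
  · rw [du, dd, h'.fderiv, dd]
    simp only [ContinuousLinearMap.comp_apply]
    congr 1
    apply Complex.ext <;> simp
  · rw [ds, dd, h'.fderiv, dd, ← map_smul]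
    simp only [ContinuousLinearMap.comp_apply]
    congr 1
    apply Complex.ext <;> simp

theorem dd_inv_sqrt_smul {E : Type*} [NormedAddCommGroup E] [NormedSpace ℝ E] {G : ℝ × ℝ → E}
    {p : ℝ × ℝ} (hp : 0 < p.2) (hG : DifferentiableAt ℝ G p) :
    DifferentiableAt ℝ (fun q => (√q.2)⁻¹ • G q) p ∧
    du (fun q => (√q.2)⁻¹ • G q) p = (√p.2)⁻¹ • du G p ∧
    ds (fun q => (√q.2)⁻¹ • G q) p = (√p.2)⁻¹ • ds G p - (1 / (2 * √p.2 ^ 3)) • G p := by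
  have h0 : √p.2 ≠ 0 := (Real.sqrt_pos.2 hp).ne'
  have h1 : HasFDerivAt (fun q : ℝ × ℝ => (√q.2)⁻¹)
      ((-(1 / (2 * √p.2)) / √p.2 ^ 2) • ContinuousLinearMap.snd ℝ ℝ ℝ) p :=
    ((Real.hasDerivAt_sqrt hp.ne').fun_inv h0).comp_hasFDerivAt p hasFDerivAt_snd
  refine ⟨h1.differentiableAt.fun_smul hG, ?_, ?_⟩
  · rw [du, dd_smul h1.differentiableAt hG]
    simp [dd, h1.fderiv]
  · rw [ds, dd_smul h1.differentiableAt hG, dd, dd, h1.fderiv]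
    simp only [smul_apply, ContinuousLinearMap.coe_snd', smul_eq_mul, mul_one, sub_eq_add_neg,
      ← neg_smul]
    congr 2
    field_simp

/-- For fixed `(u, v)` the Cauchy–Riemann operator gives `P + x Q = 0` with `P`, `Q` depending only
on `(u, v)`. Using both `x` and `-x` separates `P = 0` from `x Q = 0`, and `x² = -v² ≠ 0` gives `Q =
0`. The change of variable `v = √s` is smooth for `v > 0`, which permits reusing the formula in `(u,
s)`. -/
theorem vekua_of_monogenic_off_axis (hm : 0 < m) (hD : IsIntrinsicDomain D) {F : Para m → Cl m}
    (hF : IsMonogenicOn (axialDomain m D) F) {A B : ℂ → Cl m}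
    (hA : AnalyticOnNhd ℝ A D) (hB : AnalyticOnNhd ℝ B D)
    (hrep : ∀ x ∈ axialDomain m D,
      F x = A ⟨x 0, rad x⟩ + ((rad x)⁻¹ • vecPart x) * B ⟨x 0, rad x⟩)
    {z : ℂ} (hz : z ∈ D) (hv : 0 < z.im) :
    z.im • (dd 1 A z - dd Complex.I B z) = ((m : ℝ) - 1) • B z ∧
    dd Complex.I A z = (-1 : ℝ) • dd 1 B z := by
  set A' : ℝ × ℝ → Cl m := fun q => A (sqrtPt q)
  set B' : ℝ × ℝ → Cl m := fun q => (√q.2)⁻¹ • B (sqrtPt q)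
  set p : ℝ × ℝ := (z.re, z.im ^ 2)
  have hp : 0 < p.2 := by positivity
  have hsq : √p.2 = z.im := Real.sqrt_sq hv.le
  have hpt : sqrtPt p = z := by apply Complex.ext <;> simp [sqrtPt, hsq, p]
  obtain ⟨a1, a2, a3⟩ := dd_comp_sqrtPt hp (G := A) (by rw [hpt]; exact (hA z hz).differentiableAt)
  obtain ⟨b1, b2, b3⟩ := dd_comp_sqrtPt hp (G := B) (by rw [hpt]; exact (hB z hz).differentiableAt)
  obtain ⟨c1, c2, c3⟩ := dd_inv_sqrt_smul hp b1
  have hFeq : Set.EqOn F (axialFn A' B') (axialDomain m D) := fun x hx => by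
    rw [hrep x hx, axialFn]
    simp only [A', B', sqrtPt]
    rw [mul_smul_comm, smul_mul_assoc]
    rfl
  have key : ∀ x ∈ axialDomain m D, axisCoord x = p →
      (du A' p - (2 * p.2) • ds B' p - (m : ℝ) • B' p)
        + vecPart x * (du B' p + (2 : ℝ) • ds A' p) = 0 := fun x hx hxp => by
    have h1 := hF.2 x hx
    rw [(hFeq.eventuallyEq_of_mem ((isOpen_axialDomain hD.1).mem_nhds hx)).fderiv_eq,
      cauchyRiemann_axialFn (by rw [hxp]; exact a1) (by rw [hxp]; exact c1), hxp] at h1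
    exact h1
  obtain ⟨w, hw⟩ := exists_unit hm
  have hax : ∀ v : ℝ, |v| = z.im → axisCoord (para z.re (v • w)) = p := fun v hv' => by
    rw [axisCoord_eq, rad_para hw, hv', para_apply_zero]
  have hmem : ∀ v : ℝ, |v| = z.im → para z.re (v • w) ∈ axialDomain m D := fun v hv' => by
    change (⟨z.re, rad (para z.re (v • w))⟩ : ℂ) ∈ D
    rw [rad_para hw, hv']; exact hz
  have k1 := key _ (hmem z.im (abs_of_pos hv)) (hax z.im (abs_of_pos hv))
  have k2 := key _ (hmem (-z.im) (by rw [abs_neg, abs_of_pos hv]))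
    (hax (-z.im) (by rw [abs_neg, abs_of_pos hv]))
  set P := du A' p - (2 * p.2) • ds B' p - (m : ℝ) • B' p
  set Q := du B' p + (2 : ℝ) • ds A' p
  set X : Cl m := vecPart (para z.re (z.im • w))
  have hX : vecPart (para z.re (-z.im • w)) = -X := by
    simp only [X, vecPart_para, vec, neg_smul, map_neg]
  rw [hX, neg_mul] at k2
  have hP : P = 0 := by
    have : (2 : ℝ) • P = 0 := by
      have : (2 : ℝ) • P = (P + X * Q) + (P + -(X * Q)) := by rw [two_smul]; abel
      rw [this, k1, k2, add_zero]
    exact (smul_eq_zero.1 this).resolve_left two_ne_zero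
  have hQ : Q = 0 := by
    rw [hP, zero_add] at k1
    have h2 : X * (X * Q) = (-(axisCoord (para z.re (z.im • w))).2) • Q := vecPart_mul_vecPart _ Q
    rw [k1, mul_zero, hax z.im (abs_of_pos hv)] at h2
    exact (smul_eq_zero.1 h2.symm).resolve_left (neg_ne_zero.2 hp.ne')
  have hv0 : z.im ≠ 0 := hv.ne'
  simp only [P, Q, A', B'] at hP hQ
  rw [a2, c3, b3, hpt, hsq] at hP
  rw [a3, c2, b2, hpt, hsq] at hQ
  constructor
  · have : z.im • (dd 1 A z - (2 * p.2) • (z.im⁻¹ • (1 / (2 * z.im)) • dd Complex.I B z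
        - (1 / (2 * z.im ^ 3)) • B z) - (m : ℝ) • z.im⁻¹ • B z) = z.im • (0 : Cl m) := by rw [hP]
    rw [smul_zero] at this
    rw [← sub_eq_zero, ← this]
    simp only [p, smul_sub, smul_smul]
    have e1 : z.im * (2 * z.im ^ 2 * (z.im⁻¹ * (1 / (2 * z.im)))) = z.im := by field_simp
    have e2 : z.im * (2 * z.im ^ 2 * (1 / (2 * z.im ^ 3))) = 1 := by field_simp
    have e3 : z.im * ((m : ℝ) * z.im⁻¹) = m := by field_simp
    rw [e1, e2, e3]
    module
  · have : z.im • (z.im⁻¹ • dd 1 B z + (2 : ℝ) • (1 / (2 * z.im)) • dd Complex.I A z)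
        = z.im • (0 : Cl m) := by rw [hQ]
    rw [smul_zero, smul_add, smul_smul, smul_smul, smul_smul, mul_inv_cancel₀ hv0,
      show z.im * 2 * (1 / (2 * z.im)) = 1 by field_simp, one_smul, one_smul] at this
    rw [eq_neg_of_add_eq_zero_right this]; simp

/-- Both equations are identities between functions analytic on the connected set `D`, so they
extend from the upper half of `D`. Oddness makes `B` vanish on the axis. -/
theorem axialSystem_of_monogenic (hm : 0 < m) (hD : IsIntrinsicDomain D) {F : Para m → Cl m}
    (hF : IsMonogenicOn (axialDomain m D) F) {A B : ℂ → Cl m}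
    (hA : AnalyticOnNhd ℝ A D) (hB : AnalyticOnNhd ℝ B D)
    (hodd : ∀ z ∈ D, B ((starRingEnd ℂ) z) = -B z)
    (hrep : ∀ x ∈ axialDomain m D,
      F x = A ⟨x 0, rad x⟩ + ((rad x)⁻¹ • vecPart x) * B ⟨x 0, rad x⟩) :
    AxialSystem m D A B := by
  have hoff := fun {z : ℂ} => vekua_of_monogenic_off_axis (z := z) hm hD hF hA hB hrep
  obtain ⟨z₁, hz₁, hv₁⟩ := exists_im_pos hD
  have hev : ∀ᶠ z in 𝓝 z₁, z ∈ D ∧ 0 < z.im :=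
    Filter.Eventually.and (hD.1.mem_nhds hz₁)
      (Complex.continuous_im.continuousAt.eventually (lt_mem_nhds hv₁))
  have hpre := hD.2.1.isPreconnected
  have hA' : ∀ e : ℂ, AnalyticOnNhd ℝ (dd e A) D := fun e z hz => dd_analyticAt (hA z hz) e
  have hB' : ∀ e : ℂ, AnalyticOnNhd ℝ (dd e B) D := fun e z hz => dd_analyticAt (hB z hz) e
  refine ⟨hA, hB, ?_, ?_, fun x hx => ?_⟩
  · refine AnalyticOnNhd.eqOn_of_preconnected_of_eventuallyEq (𝕜 := ℝ) (fun z hz => ?_)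
      (fun z hz => analyticAt_const.fun_smul (hB z hz)) hpre hz₁ ?_
    · exact (Complex.imCLM.analyticAt z).fun_smul ((hA' 1 z hz).fun_sub (hB' Complex.I z hz))
    · filter_upwards [hev] with z hz using (hoff hz.1 hz.2).1
  · refine AnalyticOnNhd.eqOn_of_preconnected_of_eventuallyEq (𝕜 := ℝ) (hA' _)
      (fun z hz => analyticAt_const.fun_smul (hB' 1 z hz)) hpre hz₁ ?_
    filter_upwards [hev] with z hz using (hoff hz.1 hz.2).2
  · have h := hodd (x : ℂ) hx
    rw [Complex.conj_ofReal] at h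
    have : (2 : ℝ) • B (x : ℂ) = 0 := by
      rw [two_smul]; nth_rewrite 1 [h]; simp
    exact (smul_eq_zero.1 this).resolve_left two_ne_zero

theorem hasSum_even {E : Type*} [AddCommMonoid E] [TopologicalSpace E] {a : ℕ → E} {t : E}
    (h : HasSum a t) (h0 : ∀ k, a (2 * k + 1) = 0) : HasSum (fun k => a (2 * k)) t := by
  have hi : Function.Injective fun k : ℕ => 2 * k := fun a b h => by simpa using h
  refine (hi.hasSum_iff fun k hk => ?_).2 h
  obtain ⟨j, rfl | rfl⟩ := k.even_or_odd'
  · exact absurd ⟨j, rfl⟩ hk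
  · exact h0 j

theorem hasSum_odd {E : Type*} [AddCommMonoid E] [TopologicalSpace E] {a : ℕ → E} {t : E}
    (h : HasSum a t) (h0 : ∀ k, a (2 * k) = 0) : HasSum (fun k => a (2 * k + 1)) t := by
  have hi : Function.Injective fun k : ℕ => 2 * k + 1 := fun a b h => by simpa using h
  refine (hi.hasSum_iff fun k hk => ?_).2 h
  obtain ⟨j, rfl | rfl⟩ := k.even_or_odd'
  · exact h0 j
  · exact absurd ⟨j, rfl⟩ hk

theorem gckTerm_eq_axialCoeff (hm : (0 : ℝ) < m) (g : ℝ → Cl m) (x : Para m) (k : ℕ) :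
    gckTerm g x k
      = (rad x ^ (2 * k) * (axialCoeff m (2 * k)).1) • iteratedDeriv (2 * k) g (x 0)
        + ((rad x)⁻¹ • vecPart x) * ((rad x ^ (2 * k + 1) * (axialCoeff m (2 * k + 1)).2) •
          iteratedDeriv (2 * k + 1) g (x 0)) := by
  obtain ⟨c1, c2⟩ := axialCoeff_bessel hm k
  rw [c1, c2, gckTerm]
  generalize hr0 : rad x = r
  generalize iteratedDeriv (2 * k + 1) g (x 0) = g₁
  generalize iteratedDeriv (2 * k) g (x 0) = g₀
  generalize besselCoeff ((m : ℝ) / 2) k = b₁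
  generalize besselCoeff ((m : ℝ) / 2 - 1) k = b₀
  generalize Real.Gamma ((m : ℝ) / 2) = γ
  -- For `r = 0` and `k = 0` the scalars differ, since `0⁻¹ = 0`; equality holds because the vector
  -- part is zero.
  have hr : (r ^ (2 * k + 1) * r⁻¹) • (vecPart x * g₁) = (r ^ (2 * k)) • (vecPart x * g₁) := by
    by_cases h0 : r = 0
    · rw [vecPart_eq_zero_of_rad (hr0.trans h0)]; simp
    · congr 1; rw [pow_succ]; field_simp
  have hr' : (r⁻¹ • vecPart x) * ((r ^ (2 * k + 1) * (γ / 2 ^ (2 * k) * b₁ * (1 / 2))) • g₁)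
      = (γ / 2 ^ (2 * k) * b₁ * (1 / 2)) • ((r ^ (2 * k + 1) * r⁻¹) • (vecPart x * g₁)) := by
    rw [smul_mul_assoc, mul_smul_comm, smul_smul, smul_smul]
    congr 1; ring
  rw [hr', hr, div_pow, smul_mul_assoc, smul_add]
  simp only [smul_smul]
  congr 2 <;> ring

theorem AxialSystem.exists_hasSum {E : Type*} [NormedAddCommGroup E] [NormedSpace ℝ E]
    [CompleteSpace E] {μ : ℝ} (hμ : 0 < μ) (hD : IsOpen D) {A B : ℂ → E} (h : AxialSystem μ D A B)
    {x₀ : ℝ} (hx₀ : x₀ ∈ realTrace D) :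
    ∃ ρ : ℝ, 0 < ρ ∧ ∀ u ∈ realTrace D, |u - x₀| < ρ → ∀ v : ℝ, |v| < ρ →
      HasSum (fun k => (v ^ (2 * k) * (axialCoeff μ (2 * k)).1) • (dd 1)^[2 * k] A (u : ℂ))
        (A ⟨u, v⟩) ∧
      HasSum (fun k => (v ^ (2 * k + 1) * (axialCoeff μ (2 * k + 1)).2) •
        (dd 1)^[2 * k + 1] A (u : ℂ)) (B ⟨u, v⟩) := by
  obtain ⟨ρ₁, hρ₁, hsA⟩ := exists_hasSum_vertical (h.anA _ hx₀)
  obtain ⟨ρ₂, hρ₂, hsB⟩ := exists_hasSum_vertical (h.anB _ hx₀)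
  refine ⟨min ρ₁ ρ₂, lt_min hρ₁ hρ₂, fun u hu h1 v h2 => ?_⟩
  have hfac : ∀ k : ℕ, (k.factorial : ℝ) ≠ 0 := fun k => by exact_mod_cast k.factorial_ne_zero
  have sA := hsA u v (h1.trans_le (min_le_left _ _)) (h2.trans_le (min_le_left _ _))
  have sB := hsB u v (h1.trans_le (min_le_right _ _)) (h2.trans_le (min_le_right _ _))
  have hc : ∀ (k : ℕ) (c : ℝ), v ^ k * c = (k.factorial : ℝ)⁻¹ * v ^ k * (k.factorial * c) :=
    fun k c => by have := hfac k; field_simp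
  have sA' : HasSum (fun k => (v ^ k * (axialCoeff μ k).1) • (dd 1)^[k] A (u : ℂ)) (A ⟨u, v⟩) :=
    sA.congr_terms fun k => by rw [(AxialSystem.iterate_dd_I hμ hD k h u hu).1, smul_smul, hc]
  have sB' : HasSum (fun k => (v ^ k * (axialCoeff μ k).2) • (dd 1)^[k] A (u : ℂ)) (B ⟨u, v⟩) :=
    sB.congr_terms fun k => by rw [(AxialSystem.iterate_dd_I hμ hD k h u hu).2, smul_smul, hc]
  have tA := hasSum_even sA' fun k => by rw [(axialCoeff_parity _ k).2, mul_zero, zero_smul]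
  have tB := hasSum_odd sB' fun k => by rw [(axialCoeff_parity _ k).1, mul_zero, zero_smul]
  exact ⟨tA, tB⟩

/-- The heart of uniqueness: near the axis the values of an axially monogenic function are a series
in the derivatives of its restriction alone. -/
theorem hasSum_gckTerm (hm : 0 < m) (hD : IsIntrinsicDomain D) {F : Para m → Cl m}
    (hF : IsAxialMonogenic D F) {g : ℝ → Cl m} (hg : ∀ x₀ ∈ realTrace D, F (para x₀ 0) = g x₀)
    {x₀ : ℝ} (hx₀ : x₀ ∈ realTrace D) :
    ∀ᶠ x in 𝓝 (para x₀ 0 : Para m), HasSum (gckTerm g x) (F x) := by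
  obtain ⟨-, hmon, A, B, hA, hB, -, hodd, hrep⟩ := hF
  have hs := axialSystem_of_monogenic hm hD hmon hA hB hodd hrep
  have hm' : (0 : ℝ) < m := by exact_mod_cast hm
  obtain ⟨ρ, hρ, hsum⟩ := hs.exists_hasSum hm' hD.1 hx₀
  have hgA : ∀ u ∈ realTrace D, g u = A (u : ℂ) := fun u hu => by
    rw [← hg u hu, hrep _ (para_zero_mem hu), rad_para_zero, inv_zero, zero_smul, zero_mul, add_zero]
    rfl
  have hg' := iteratedDeriv_ofReal hD.1 hA hgA
  have hc : Continuous fun x : Para m => x 0 := by fun_prop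
  have e1 : ∀ᶠ x in 𝓝 (para x₀ 0 : Para m), |x 0 - x₀| < ρ :=
    (hc.sub continuous_const).abs.continuousAt.eventually_lt continuousAt_const
      (by simp [para_apply_zero, hρ])
  have e2 : ∀ᶠ x in 𝓝 (para x₀ 0 : Para m), |rad x| < ρ :=
    continuous_rad.abs.continuousAt.eventually_lt continuousAt_const (by simp [rad_para_zero, hρ])
  have e3 : ∀ᶠ x in 𝓝 (para x₀ 0 : Para m), x 0 ∈ realTrace D :=
    hc.continuousAt.eventually_mem ((isOpen_realTrace hD.1).mem_nhds hx₀)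
  filter_upwards [e1, e2, e3, (isOpen_axialDomain hD.1).mem_nhds (para_zero_mem hx₀)]
    with x h1 h2 h3 h4
  obtain ⟨tA, tB⟩ := hsum _ h3 h1 _ h2
  rw [hrep x h4]
  refine (tA.add ((mulL m ((rad x)⁻¹ • vecPart x)).hasSum tB)).congr_terms fun k => ?_
  rw [gckTerm_eq_axialCoeff hm', hg' _ _ h3, hg' _ _ h3]
  rfl

theorem isGCKExtension_of_axialMonogenic (hm : 0 < m) (hD : IsIntrinsicDomain D)
    {F : Para m → Cl m} (hF : IsAxialMonogenic D F) {g : ℝ → Cl m}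
    (hg : ∀ x₀ ∈ realTrace D, F (para x₀ 0) = g x₀) : IsGCKExtension D g F :=
  ⟨hF, fun _ hx₀ => hasSum_gckTerm hm hD hF hg hx₀⟩

/-- Near one real point both functions are sums of the same series; the identity theorem does the
rest. -/
theorem IsGCKExtension.eqOn (hm : 0 < m) (hD : IsIntrinsicDomain D) {F G : Para m → Cl m}
    {g : ℝ → Cl m} (hF : IsGCKExtension D g F) (hG : IsGCKExtension D g G) :
    Set.EqOn F G (axialDomain m D) := by
  obtain ⟨x₀, hx₀⟩ := realTrace_nonempty hD
  refine eqOn_axialDomain hm hD hF.1.1 hG.1.1 hx₀ ?_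
  filter_upwards [hF.2 x₀ hx₀, hG.2 x₀ hx₀] with x h1 h2 using h1.unique h2

/-- Reduces every statement about `GCK` to a check on the real line, and makes the choice in its
definition immaterial on the domain. -/
theorem gckWellDefined_of_axialMonogenic (hm : 0 < m) (hD : IsIntrinsicDomain D)
    {F : Para m → Cl m} (hF : IsAxialMonogenic D F) {g : ℝ → Cl m}
    (hg : ∀ x₀ ∈ realTrace D, F (para x₀ 0) = g x₀) :
    GCKWellDefined m D g ∧ Set.EqOn F (GCK m D g) (axialDomain m D) := by
  have hex : ∃ F : Para m → Cl m, IsGCKExtension D g F :=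
    ⟨F, isGCKExtension_of_axialMonogenic hm hD hF hg⟩
  have hG : IsGCKExtension D g (GCK m D g) := by
    rw [GCK, dif_pos hex]; exact hex.choose_spec
  have huniq : ∀ F : Para m → Cl m, IsAxialMonogenic D F →
      (∀ x₀ ∈ realTrace D, F (para x₀ 0) = g x₀) → Set.EqOn F (GCK m D g) (axialDomain m D) :=
    fun F hF hg => (isGCKExtension_of_axialMonogenic hm hD hF hg).eqOn hm hD hG
  refine ⟨⟨hG, fun x₀ hx₀ => ?_, huniq⟩, huniq F hF hg⟩
  rw [← huniq F hF hg (para_zero_mem hx₀), hg x₀ hx₀]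

end GCKExtension

/-! ### The slice extension -/

theorem dd_iterate_clm {V E E' : Type*} [NormedAddCommGroup V] [NormedSpace ℝ V]
    [NormedAddCommGroup E] [NormedSpace ℝ E] [CompleteSpace E] [NormedAddCommGroup E']
    [NormedSpace ℝ E'] (l : E →L[ℝ] E') (e : V) (k : ℕ) {G : V → E} {p : V}
    (hG : AnalyticAt ℝ G p) : (dd e)^[k] (fun q => l (G q)) p = l ((dd e)^[k] G p) := by
  induction k generalizing p with
  | zero => rfl
  | succ k ih =>
    rw [Function.iterate_succ_apply', Function.iterate_succ_apply']
    have : (dd e)^[k] (fun q => l (G q)) =ᶠ[𝓝 p] fun q => l ((dd e)^[k] G q) := by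
      filter_upwards [hG.eventually_analyticAt] with q hq using ih hq
    rw [(dd_congr this e).eq_of_nhds, dd_clm l (dd_iterate_analyticAt hG e k).differentiableAt]

section Slice

variable {m : ℕ} {D : Set ℂ}

theorem sliceExtC_eq {f : ℂ → ℂ} {ψ φ : ℝ × ℝ → ℝ}
    (h : ∀ z ∈ D, (f z).re = ψ (z.re, z.im ^ 2) ∧ (f z).im = z.im * φ (z.re, z.im ^ 2))
    {x : Para m} (hx : x ∈ axialDomain m D) (c : Cl m) :
    sliceExtC m f x * c = axialFn (fun q => ψ q • c) (fun q => φ q • c) x := by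
  obtain ⟨h1, h2⟩ := h _ hx
  rw [sliceExtC, axialFn, alphaPart, betaPart, h1, h2, ← axisCoord_eq, add_mul, ← Algebra.smul_def,
    smul_mul_assoc, mul_smul_comm]
  congr 1
  by_cases h0 : rad x = 0
  · rw [vecPart_eq_zero_of_rad h0]; simp
  · simp only
    rw [inv_mul_cancel_left₀ h0]

/-- The system is real linear and the constants `c i` stand on the right, so solutions for the
scalar components add up to a Clifford-valued one. -/
theorem exists_axialFn_of_isHolRep (hD : IsIntrinsicDomain D) {n : ℕ} {h : Fin n → ℂ → ℂ}
    {c : Fin n → Cl m} {g : ℝ → Cl m} (hg : IsHolRep D h c g) :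
    ∃ A B : ℝ × ℝ → Cl m, (∀ z ∈ D, VekuaAt 1 A B (z.re, z.im ^ 2)) ∧
      (∀ x ∈ axialDomain m D, ∑ i, sliceExtC m (h i) x * c i = axialFn A B x) ∧
      ∀ x₀ ∈ realTrace D, g x₀ = A (x₀, 0) := by
  choose ψ φ hψφ using fun i => exists_vekuaAt_of_intrinsicHol hD (hg.1 i)
  refine ⟨fun q => ∑ i, ψ i q • c i, fun q => ∑ i, φ i q • c i, fun z hz => ?_, fun x hx => ?_,
    fun x₀ hx₀ => ?_⟩
  · exact VekuaAt.sum _ fun i _ =>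
      (hψφ i z hz).1.clm (ContinuousLinearMap.toSpanSingleton ℝ (c i))
  · rw [Finset.sum_congr rfl fun i _ => sliceExtC_eq (fun z hz => (hψφ i z hz).2) hx (c i)]
    simp only [axialFn, Finset.sum_add_distrib, Finset.mul_sum]
  · rw [hg.2 x₀ hx₀]
    refine Finset.sum_congr rfl fun i _ => ?_
    have := (hψφ i (x₀ : ℂ) hx₀).2.1
    rw [Complex.ofReal_re, Complex.ofReal_im, zero_pow two_ne_zero] at this
    rw [← this]; rfl

theorem eqOn_of_eqOn_realTrace (hD : IsIntrinsicDomain D) {f g : ℂ → ℂ}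
    (hf : DifferentiableOn ℂ f D) (hg : DifferentiableOn ℂ g D)
    (h : ∀ x ∈ realTrace D, f (x : ℂ) = g x) : Set.EqOn f g D := by
  obtain ⟨x₀, hx₀⟩ := realTrace_nonempty hD
  refine (hf.analyticOnNhd hD.1).eqOn_of_preconnected_of_frequently_eq (hg.analyticOnNhd hD.1)
    hD.2.1.isPreconnected (show (x₀ : ℂ) ∈ D from hx₀) ?_
  have ht : Tendsto (fun t : ℝ => (t : ℂ)) (𝓝[≠] x₀) (𝓝[≠] (x₀ : ℂ)) := by
    refine tendsto_nhdsWithin_of_tendsto_nhds_of_eventually_within _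
      (Complex.continuous_ofReal.continuousAt.tendsto.mono_left nhdsWithin_le_nhds) ?_
    filter_upwards [self_mem_nhdsWithin] with t ht h'
    exact ht (Complex.ofReal_injective h')
  refine ht.frequently (Eventually.frequently ?_)
  filter_upwards [nhdsWithin_le_nhds ((isOpen_realTrace hD.1).mem_nhds hx₀)] with t ht using h t ht

/-- In each basis coordinate both representations become scalar holomorphic functions that agree on
the real trace, hence on `D`. The coordinates of the constants are real, so real and imaginary parts
can be taken separately. -/
theorem IsHolRep.sum_smul_eq (hD : IsIntrinsicDomain D) {n n' : ℕ} {h : Fin n → ℂ → ℂ}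
    {c : Fin n → Cl m} {h' : Fin n' → ℂ → ℂ} {c' : Fin n' → Cl m} {g : ℝ → Cl m}
    (hg : IsHolRep D h c g) (hg' : IsHolRep D h' c' g) {z : ℂ} (hz : z ∈ D) :
    ∑ i, (h i z).re • c i = ∑ i, (h' i z).re • c' i ∧
    ∑ i, (h i z).im • c i = ∑ i, (h' i z).im • c' i := by
  have key : ∀ S : Finset (Fin m), ∑ i, h i z * ((clBasis m).coord S (c i) : ℝ)
      = ∑ i, h' i z * ((clBasis m).coord S (c' i) : ℝ) := fun S => by
    refine eqOn_of_eqOn_realTrace hD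
      (f := fun z => ∑ i, h i z * ((clBasis m).coord S (c i) : ℝ))
      (g := fun z => ∑ i, h' i z * ((clBasis m).coord S (c' i) : ℝ))
      (DifferentiableOn.fun_sum fun i _ => (hg.1 i).1.mul_const _)
      (DifferentiableOn.fun_sum fun i _ => (hg'.1 i).1.mul_const _) (fun x hx => ?_) hz
    have hreal : ∀ {f : ℂ → ℂ}, IsIntrinsicHol D f → f (x : ℂ) = (alphaPart f x 0 : ℝ) :=
      fun {f} hf => Complex.ext rfl
        (by rw [intrinsicHol_real hf (show (x : ℂ) ∈ D from hx) (Complex.ofReal_im x)]; simp)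
    have e := congrArg (fun a => (((clBasis m).coord S a : ℝ) : ℂ))
      ((hg.2 x hx).symm.trans (hg'.2 x hx))
    simp only [map_sum, map_smul, smul_eq_mul] at e
    push_cast at e
    simp only [hreal (hg.1 _), hreal (hg'.1 _)]
    exact e
  have ext : ∀ a b : Cl m, (∀ S, (clBasis m).coord S a = (clBasis m).coord S b) → a = b :=
    fun a b hab => (clBasis m).ext_elem hab
  constructor <;> refine ext _ _ fun S => ?_
  · have := congrArg Complex.re (key S)
    simpa only [map_sum, map_smul, smul_eq_mul, Complex.re_sum, Complex.re_mul_ofReal] using this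
  · have := congrArg Complex.im (key S)
    simpa only [map_sum, map_smul, smul_eq_mul, Complex.im_sum, Complex.im_mul_ofReal] using this

theorem sum_sliceExtC_mul {n : ℕ} (h : Fin n → ℂ → ℂ) (c : Fin n → Cl m) (x : Para m) :
    ∑ i, sliceExtC m (h i) x * c i = ∑ i, (h i ⟨x 0, rad x⟩).re • c i
      + ((rad x)⁻¹ • vecPart x) * ∑ i, (h i ⟨x 0, rad x⟩).im • c i := by
  rw [Finset.mul_sum, ← Finset.sum_add_distrib]
  refine Finset.sum_congr rfl fun i _ => ?_
  rw [sliceExtC, alphaPart, betaPart, add_mul, ← Algebra.smul_def, mul_smul_comm, smul_mul_assoc,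
    smul_mul_assoc, smul_smul, mul_comm]

/-- The extension depends only on `∑ Re(h_i) c_i` and `∑ Im(h_i) c_i`, which are the same for all
representations; the chosen one may thus be replaced by any other. -/
theorem sliceExt_eq (hD : IsIntrinsicDomain D) {n : ℕ} {h : Fin n → ℂ → ℂ}
    {c : Fin n → Cl m} {g : ℝ → Cl m} (hg : IsHolRep D h c g) {x : Para m}
    (hx : x ∈ axialDomain m D) : sliceExt m D g x = ∑ i, sliceExtC m (h i) x * c i := by
  have H : MemA D g := ⟨n, h, c, hg⟩
  rw [sliceExt, dif_pos H]
  have hspec := H.choose_spec.choose_spec.choose_spec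
  obtain ⟨h1, h2⟩ := hspec.sum_smul_eq hD hg (z := ⟨x 0, rad x⟩) hx
  simp only [sum_sliceExtC_mul]
  rw [h1, h2]

/-- The chain rule along `z ↦ (Re z, (Im z)²)`. -/
theorem dd_comp_sq {E : Type*} [NormedAddCommGroup E] [NormedSpace ℝ E] {G : ℝ × ℝ → E} {z : ℂ}
    (hG : DifferentiableAt ℝ G (z.re, z.im ^ 2)) :
    dd 1 (fun ζ : ℂ => G (ζ.re, ζ.im ^ 2)) z = du G (z.re, z.im ^ 2) ∧
    dd Complex.I (fun ζ : ℂ => G (ζ.re, ζ.im ^ 2)) z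
      = (2 * z.im) • ds G (z.re, z.im ^ 2) := by
  have h2 : HasFDerivAt (fun ζ : ℂ => ζ.im ^ 2) ((2 * z.im) • Complex.imCLM) z := by
    have h : HasFDerivAt (fun ζ : ℂ => ζ.im) Complex.imCLM z := Complex.imCLM.hasFDerivAt
    simpa using h.pow 2
  have h1 : HasFDerivAt (fun ζ : ℂ => ζ.re) Complex.reCLM z := Complex.reCLM.hasFDerivAt
  have h : HasFDerivAt (fun ζ : ℂ => G (ζ.re, ζ.im ^ 2)) _ z :=
    HasFDerivAt.comp z (g := G) hG.hasFDerivAt (h1.prodMk h2)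
  constructor
  · rw [dd, h.fderiv, du, dd]
    simp
  · rw [dd, h.fderiv, ds, dd, ← map_smul]
    simp

/-- On the plane of `1` and `w` the function is `A(u, v²) + w v B(u, v²)`. As `w² = -1`, the two
equations with `μ = 1` are the Cauchy–Riemann equations of this plane. -/
theorem isSliceMonogenicOn_of_vekuaAt (hD : IsIntrinsicDomain D) {A B : ℝ × ℝ → Cl m}
    (h : ∀ z ∈ D, VekuaAt 1 A B (z.re, z.im ^ 2)) {F : Para m → Cl m}
    (hF : Set.EqOn F (axialFn A B) (axialDomain m D)) :
    IsSliceMonogenicOn (axialDomain m D) F := by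
  intro w hw z hz
  have hax : ∀ ζ : ℂ, axisCoord (para ζ.re (ζ.im • w)) = (ζ.re, ζ.im ^ 2) := fun ζ => by
    rw [axisCoord_eq, rad_para hw, para_apply_zero, sq_abs]
  have hv : VekuaAt 1 A B (z.re, z.im ^ 2) := by
    have := vekuaAt_axisCoord h hz
    rwa [hax] at this
  have hsq : AnalyticAt ℝ (fun ζ : ℂ => ((ζ.re, ζ.im ^ 2) : ℝ × ℝ)) z :=
    (Complex.reCLM.analyticAt z).prod ((Complex.imCLM.analyticAt z).fun_pow 2)
  have hA : AnalyticAt ℝ (fun ζ : ℂ => A (ζ.re, ζ.im ^ 2)) z := hv.1.comp_of_eq hsq rfl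
  have hB : AnalyticAt ℝ (fun ζ : ℂ => B (ζ.re, ζ.im ^ 2)) z := hv.2.1.comp_of_eq hsq rfl
  have hvB : DifferentiableAt ℝ (fun ζ : ℂ => ζ.im • B (ζ.re, ζ.im ^ 2)) z :=
    Complex.imCLM.differentiableAt.fun_smul hB.differentiableAt
  have hwB : DifferentiableAt ℝ (fun ζ : ℂ => vec w * (ζ.im • B (ζ.re, ζ.im ^ 2))) z :=
    (mulL m (vec w)).differentiableAt.comp z hvB
  have hev : (fun ζ : ℂ => F (para ζ.re (ζ.im • w))) =ᶠ[𝓝 z]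
      fun ζ => A (ζ.re, ζ.im ^ 2) + vec w * (ζ.im • B (ζ.re, ζ.im ^ 2)) := by
    have hc : ContinuousAt (fun ζ : ℂ => para ζ.re (ζ.im • w)) z := by
      rw [show (fun ζ : ℂ => para ζ.re (ζ.im • w)) = sliceL w from
        funext fun ζ => (sliceL_apply w ζ).symm]
      exact (sliceL w).continuous.continuousAt
    filter_upwards [hc.eventually_mem ((isOpen_axialDomain hD.1).mem_nhds hz)] with ζ hζ
    rw [hF hζ, axialFn, hax, vecPart_para, vec, map_smul, smul_mul_assoc, mul_smul_comm]
    rfl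
  refine ⟨(hA.differentiableAt.add hwB).congr_of_eventuallyEq hev, ?_⟩
  change dd 1 (fun ζ : ℂ => F (para ζ.re (ζ.im • w))) z
    + vec w * dd Complex.I (fun ζ : ℂ => F (para ζ.re (ζ.im • w))) z = 0
  have hmul : ∀ e : ℂ, dd e (fun ζ : ℂ => vec w * (ζ.im • B (ζ.re, ζ.im ^ 2))) z
      = vec w * dd e (fun ζ : ℂ => ζ.im • B (ζ.re, ζ.im ^ 2)) z := fun e =>
    dd_clm (mulL m (vec w)) hvB e
  rw [(dd_congr hev 1).eq_of_nhds, (dd_congr hev Complex.I).eq_of_nhds,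
    dd_add hA.differentiableAt hwB, dd_add hA.differentiableAt hwB, hmul, hmul,
    dd_one_im_smul hB, dd_I_im_smul hB]
  obtain ⟨a1, a2⟩ := dd_comp_sq hv.1.differentiableAt
  obtain ⟨b1, b2⟩ := dd_comp_sq hv.2.1.differentiableAt
  obtain ⟨e1, e2⟩ := hv.2.2.self_of_nhds
  have hww : ∀ y : Cl m, vec w * (vec w * y) = -y := fun y => by
    rw [← mul_assoc, vec_mul_vec, hw, ← Algebra.smul_def]; simp
  rw [a1, a2, b1, b2, e1, e2, mul_add (vec w), hww]
  simp only [mul_smul_comm]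
  module

/-! ### Stability of the data space under differentiation and scaling. -/

theorem deriv_conj_of_intrinsicHol (hD : IsOpen D) {f : ℂ → ℂ} (hf : IsIntrinsicHol D f) {z : ℂ}
    (hz : z ∈ D) : deriv f ((starRingEnd ℂ) z) = (starRingEnd ℂ) (deriv f z) := by
  have h : HasDerivAt f (deriv f z) z := (hf.1.differentiableAt (hD.mem_nhds hz)).hasDerivAt
  have h2 := h.conj_conj
  have hc : Tendsto (starRingEnd ℂ) (𝓝 ((starRingEnd ℂ) z)) (𝓝 z) := by
    have := Complex.continuous_conj.tendsto ((starRingEnd ℂ) z)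
    rwa [Complex.conj_conj] at this
  refine (h2.congr_of_eventuallyEq ?_).deriv
  filter_upwards [hc.eventually (hD.mem_nhds hz)] with ζ hζ
  have := hf.2 _ hζ
  rw [Complex.conj_conj] at this
  simpa using this

theorem IsIntrinsicHol.deriv (hD : IsOpen D) {f : ℂ → ℂ} (hf : IsIntrinsicHol D f) :
    IsIntrinsicHol D (deriv f) :=
  ⟨hf.1.deriv hD, fun _ hz => deriv_conj_of_intrinsicHol hD hf hz⟩

theorem MemA.deriv (hD : IsOpen D) {g : ℝ → Cl m} (hg : MemA D g) : MemA D (deriv g) := by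
  obtain ⟨n, h, c, hh, hrep⟩ := hg
  refine ⟨n, fun i => _root_.deriv (h i), c, fun i => (hh i).deriv hD, fun x hx => ?_⟩
  have hev : g =ᶠ[𝓝 x] fun t => ∑ i, alphaPart (h i) t 0 • c i := by
    filter_upwards [(isOpen_realTrace hD).mem_nhds hx] with t ht using hrep t ht
  rw [hev.deriv_eq]
  refine (HasDerivAt.fun_sum fun i _ => ?_).deriv
  have hd : HasDerivAt (h i) (_root_.deriv (h i) (x : ℂ)) (x : ℂ) :=
    ((hh i).1.differentiableAt (hD.mem_nhds hx)).hasDerivAt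
  exact hd.real_of_complex.smul_const (c i)

theorem MemA.iteratedDeriv (hD : IsOpen D) {g : ℝ → Cl m} (hg : MemA D g) (k : ℕ) :
    MemA D (iteratedDeriv k g) := by
  induction k with
  | zero => simpa using hg
  | succ k ih => rw [iteratedDeriv_succ]; exact ih.deriv hD

theorem MemA.const_smul {g : ℝ → Cl m} (hg : MemA D g) (t : ℝ) : MemA D fun x => t • g x := by
  obtain ⟨n, h, c, hh, hrep⟩ := hg
  refine ⟨n, h, fun i => t • c i, hh, fun x hx => ?_⟩
  simp only [hrep x hx, Finset.smul_sum]
  exact Finset.sum_congr rfl fun i _ => smul_comm _ _ _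

/-- With `s = r²` one has `∂_r = 2 r ∂_s`, so each factor `(1/r) ∂_r` is `2 ∂_s`. -/
theorem radialOp_eq (hD : IsOpen D) {f : ℂ → ℂ} {ψ : ℝ × ℝ → ℝ}
    (hψ : ∀ z ∈ D, AnalyticAt ℝ ψ (z.re, z.im ^ 2) ∧ (f z).re = ψ (z.re, z.im ^ 2)) (x₀ : ℝ)
    (k : ℕ) : ∀ r : ℝ, (⟨x₀, r⟩ : ℂ) ∈ D → r ≠ 0 →
      radialOp k (alphaPart f x₀) r = 2 ^ k * ds^[k] ψ (x₀, r ^ 2) := by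
  have hc : Continuous fun r : ℝ => (⟨x₀, r⟩ : ℂ) := by
    have : (fun r : ℝ => (⟨x₀, r⟩ : ℂ)) = fun r : ℝ => (x₀ : ℂ) + (r : ℂ) * Complex.I := by
      funext q; apply Complex.ext <;> simp
    rw [this]; fun_prop
  induction k with
  | zero => intro r hr _; simpa [radialOp, alphaPart] using (hψ _ hr).2
  | succ k ih =>
    intro r hr h0
    have hstep : radialOp (k + 1) (alphaPart f x₀) r
        = r⁻¹ * deriv (radialOp k (alphaPart f x₀)) r := by
      simp only [radialOp, Function.iterate_succ_apply']
    have hev : radialOp k (alphaPart f x₀) =ᶠ[𝓝 r] fun t => 2 ^ k * ds^[k] ψ (x₀, t ^ 2) := by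
      filter_upwards [hc.continuousAt.eventually_mem (hD.mem_nhds hr), eventually_ne_nhds h0]
        with t ht ht0 using ih t ht ht0
    have hG := (dd_iterate_analyticAt (hψ _ hr).1 (0, 1) k).differentiableAt
    have h1 : HasDerivAt (fun t : ℝ => ((x₀, t ^ 2) : ℝ × ℝ)) ((2 * r) • (0, 1)) r := by
      have := (hasDerivAt_const r x₀).prodMk ((hasDerivAt_id' r).fun_pow 2)
      simpa using this
    have h2 : HasDerivAt (fun t : ℝ => ds^[k] ψ (x₀, t ^ 2))
        ((2 * r) • ds (ds^[k] ψ) (x₀, r ^ 2)) r := by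
      have := hG.hasFDerivAt.comp_hasDerivAt r h1
      rwa [map_smul] at this
    rw [hstep, hev.deriv_eq, (h2.const_mul _).deriv, Function.iterate_succ_apply', smul_eq_mul]
    field_simp
    ring

/-- The limit exists because `∂_s^k ψ` is analytic, hence continuous, across `s = 0`. -/
theorem radialAtZero_eq (hD : IsOpen D) {f : ℂ → ℂ} {ψ : ℝ × ℝ → ℝ}
    (hψ : ∀ z ∈ D, AnalyticAt ℝ ψ (z.re, z.im ^ 2) ∧ (f z).re = ψ (z.re, z.im ^ 2)) {x₀ : ℝ}
    (hx₀ : x₀ ∈ realTrace D) (k : ℕ) :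
    Tendsto (radialOp k (alphaPart f x₀)) (𝓝[≠] 0) (𝓝 (radialAtZero k f x₀)) ∧
    radialAtZero k f x₀ = 2 ^ k * ds^[k] ψ (x₀, 0) := by
  have hc : Continuous fun r : ℝ => (⟨x₀, r⟩ : ℂ) := by
    have : (fun r : ℝ => (⟨x₀, r⟩ : ℂ)) = fun r : ℝ => (x₀ : ℂ) + (r : ℂ) * Complex.I := by
      funext q; apply Complex.ext <;> simp
    rw [this]; fun_prop
  have hcont : ContinuousAt (fun r : ℝ => 2 ^ k * ds^[k] ψ (x₀, r ^ 2)) 0 := by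
    have h1 := (hψ _ hx₀).1
    rw [Complex.ofReal_re, Complex.ofReal_im, zero_pow two_ne_zero] at h1
    have h2 : ContinuousAt (ds^[k] ψ) ((fun r : ℝ => ((x₀, r ^ 2) : ℝ × ℝ)) 0) := by
      simpa using (dd_iterate_analyticAt h1 (0, 1) k).continuousAt
    have h3 : ContinuousAt (fun r : ℝ => ((x₀, r ^ 2) : ℝ × ℝ)) 0 := by fun_prop
    exact continuousAt_const.mul (ContinuousAt.comp h2 h3)
  have hlim : Tendsto (radialOp k (alphaPart f x₀)) (𝓝[≠] 0) (𝓝 (2 ^ k * ds^[k] ψ (x₀, 0))) := by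
    have := hcont.tendsto.mono_left (nhdsWithin_le_nhds (s := {0}ᶜ))
    rw [zero_pow two_ne_zero] at this
    refine this.congr' ?_
    filter_upwards [self_mem_nhdsWithin, nhdsWithin_le_nhds
      (hc.continuousAt.eventually_mem (hD.mem_nhds (show (⟨x₀, 0⟩ : ℂ) ∈ D from hx₀)))]
      with r h0 hr
    exact (radialOp_eq hD hψ x₀ k r hr h0).symm
  have : radialAtZero k f x₀ = 2 ^ k * ds^[k] ψ (x₀, 0) := hlim.limUnder_eq
  exact ⟨by rw [this]; exact hlim, this⟩

theorem IsAxialMonogenic.const_smul {F : Para m → Cl m}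
    (hF : IsAxialMonogenic D F) (c : ℝ) : IsAxialMonogenic D fun x => c • F x := by
  obtain ⟨han, hmon, A, B, hA, hB, hAe, hBo, hrep⟩ := hF
  have han' : AnalyticOnNhd ℝ (fun x => c • F x) (axialDomain m D) := fun x hx =>
    analyticAt_const.fun_smul (han x hx)
  refine ⟨han', ⟨fun x hx => (han' x hx).contDiffAt.contDiffWithinAt, fun x hx => ?_⟩,
    fun z => c • A z, fun z => c • B z, fun z hz => analyticAt_const.fun_smul (hA z hz),
    fun z hz => analyticAt_const.fun_smul (hB z hz), fun z hz => by simp only [hAe z hz],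
    fun z hz => by simp only [hBo z hz, smul_neg], fun x hx => ?_⟩
  · have := hmon.2 x hx
    rw [fderiv_fun_const_smul (han x hx).differentiableAt]
    simp only [smul_apply, mul_smul_comm, ← Finset.smul_sum, ← smul_add]
    rw [this, smul_zero]
  · simp only [hrep x hx, smul_add, mul_smul_comm]

/-- Division by `c` keeps the constant outside `GCK`, as the first part of the theorem requires,
without a separate proof that `GCK` is linear. -/
theorem gck_of_axialMonogenic_smul (hm : 0 < m) (hD : IsIntrinsicDomain D) {F : Para m → Cl m}
    (hF : IsAxialMonogenic D F) {c : ℝ} (hc : c ≠ 0) {g : ℝ → Cl m}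
    (hg : ∀ x₀ ∈ realTrace D, F (para x₀ 0) = c • g x₀) :
    GCKWellDefined m D g ∧ ∀ x ∈ axialDomain m D, F x = c • GCK m D g x := by
  obtain ⟨h1, h2⟩ := gckWellDefined_of_axialMonogenic hm hD (hF.const_smul c⁻¹) (g := g)
    fun x₀ hx₀ => by rw [hg x₀ hx₀, smul_smul, inv_mul_cancel₀ hc, one_smul]
  exact ⟨h1, fun x hx => by rw [← h2 hx, smul_smul, mul_inv_cancel₀ hc, one_smul]⟩

end Slice

/-! ### The constants and the two halves of the theorem. -/

theorem gammaConst_mul {m n : ℕ} (hm : m = 2 * n + 1) :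
    gammaConst m * ((-2) ^ n * (Nat.doubleFactorial (2 * n - 1) : ℝ))
      = 2 ^ n * (Nat.doubleFactorial (2 * n) : ℝ) := by
  have h : (Nat.doubleFactorial (2 * n - 1) : ℝ) ≠ 0 := by
    exact_mod_cast (Nat.doubleFactorial_pos _).ne'
  subst hm
  -- The truncated `m - 2` and `2n - 1` agree for `n = 0` as well, where both are `0` and give the
  -- double factorial `1`.
  rw [gammaConst, show 2 * n + 1 - 2 = 2 * n - 1 by omega, show 2 * n + 1 - 1 = 2 * n by omega,
    show 2 * n / 2 = n by omega]
  have h2 : (-1 : ℝ) ^ n * (-2) ^ n = 2 ^ n := by rw [← mul_pow]; norm_num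
  rw [← h2]
  field_simp

theorem gammaConst_ne_zero (m : ℕ) : gammaConst m ≠ 0 := by
  have h := fun k : ℕ => (Nat.cast_pos (α := ℝ)).2 (Nat.doubleFactorial_pos k)
  exact mul_ne_zero (pow_ne_zero _ (by norm_num)) (div_pos (h _) (h _)).ne'

/-- The iterated Laplacian of an intrinsic slice function as a generalized CK-extension. -/
theorem fueterSce_gck_intrinsic {m n : ℕ} (hm : m = 2 * n + 1) {D : Set ℂ}
    (hD : IsIntrinsicDomain D) {f : ℂ → ℂ} (hf : IsIntrinsicHol D f) :
    (∀ x₀ ∈ realTrace D,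
      Tendsto (radialOp n (alphaPart f x₀)) (𝓝[≠] 0) (𝓝 (radialAtZero n f x₀))) ∧
    AnalyticOnNhd ℝ (sliceExtC m f) (axialDomain m D) ∧
    (GCKWellDefined m D (fun x₀ => algebraMap ℝ (Cl m) (radialAtZero n f x₀)) ∧
      ∀ x ∈ axialDomain m D, laplacePow n (sliceExtC m f) x
        = (Nat.doubleFactorial (2 * n) : ℝ) •
          GCK m D (fun x₀ => algebraMap ℝ (Cl m) (radialAtZero n f x₀)) x) ∧
    (GCKWellDefined m D (fun x₀ => algebraMap ℝ (Cl m)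
        (iteratedDeriv (2 * n) (fun t : ℝ => alphaPart f t 0) x₀)) ∧
      ∀ x ∈ axialDomain m D, laplacePow n (sliceExtC m f) x
        = gammaConst m • GCK m D (fun x₀ => algebraMap ℝ (Cl m)
          (iteratedDeriv (2 * n) (fun t : ℝ => alphaPart f t 0) x₀)) x) := by
  obtain ⟨ψ, φ, hψφ⟩ := exists_vekuaAt_of_intrinsicHol hD hf
  have hm0 : 0 < m := by omega
  have haxis : ∀ x₀ ∈ realTrace D, VekuaAt 1 ψ φ (x₀, 0) ∧ alphaPart f x₀ 0 = ψ (x₀, 0) :=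
    fun x₀ hx₀ => by
      have := hψφ (x₀ : ℂ) hx₀
      rw [Complex.ofReal_re, Complex.ofReal_im, zero_pow two_ne_zero] at this
      exact ⟨this.1, this.2.1⟩
  have hrad := fun {x₀ : ℝ} (hx₀ : x₀ ∈ realTrace D) =>
    radialAtZero_eq hD.1 (fun z hz => ⟨(hψφ z hz).1.1, (hψφ z hz).2.1⟩) hx₀ n
  -- The inclusion of the scalars, which turns the real solution `(ψ, φ)` into one with values in
  -- `ℝ_m`.
  set l : ℝ →L[ℝ] Cl m := ContinuousLinearMap.toSpanSingleton ℝ 1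
  have hl : ∀ t, algebraMap ℝ (Cl m) t = l t := fun t => Algebra.algebraMap_eq_smul_one t
  have hv : ∀ z ∈ D, VekuaAt 1 (fun q => l (ψ q)) (fun q => l (φ q)) (z.re, z.im ^ 2) :=
    fun z hz => (hψφ z hz).1.clm l
  have hF : Set.EqOn (sliceExtC m f) (axialFn (fun q => l (ψ q)) (fun q => l (φ q)))
      (axialDomain m D) := fun x hx => by
    rw [← mul_one (sliceExtC m f x), sliceExtC_eq (fun z hz => (hψφ z hz).2) hx]
    rfl
  obtain ⟨hL, hL0⟩ := laplacePow_fueterSce hD.1 hm hv hF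
  have hL1 : ∀ x₀ ∈ realTrace D, laplacePow n (sliceExtC m f) (para x₀ 0)
      = (2 ^ n * (Nat.doubleFactorial (2 * n) : ℝ)) • l (ds^[n] ψ (x₀, 0)) := fun x₀ hx₀ => by
    rw [hL0 x₀ hx₀, dd_iterate_clm l _ n (haxis x₀ hx₀).1.1]
  refine ⟨fun x₀ hx₀ => (hrad hx₀).1, analyticOnNhd_of_vekuaAt hD.1 hv hF,
    gck_of_axialMonogenic_smul hm0 hD hL ?_ fun x₀ hx₀ => ?_,
    gck_of_axialMonogenic_smul hm0 hD hL (gammaConst_ne_zero m) fun x₀ hx₀ => ?_⟩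
  · exact_mod_cast (Nat.doubleFactorial_pos _).ne'
  -- The factor `2^n` is absorbed by `((1/r) ∂_r)^n = 2^n ∂_s^n`, which leaves `(2n)!! = (m-1)!!`.
  · rw [hL1 x₀ hx₀, (hrad hx₀).2, hl, ← map_smul, ← map_smul, smul_eq_mul, smul_eq_mul]
    congr 1; ring
  · have := VekuaAt.iteratedDeriv_axis (isOpen_realTrace hD.1) (fun u hu => (haxis u hu).1)
      (fun u hu => (haxis u hu).2) n x₀ hx₀
    rw [this, hL1 x₀ hx₀, hl, ← map_smul, ← map_smul, smul_smul, gammaConst_mul hm]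

/-- The Fueter–Sce map on slice extensions with Clifford-valued data. -/
theorem fueterSce_gck_slice {m n : ℕ} (hm : m = 2 * n + 1) {D : Set ℂ}
    (hD : IsIntrinsicDomain D) {f₀ : ℝ → Cl m} (hf₀ : MemA D f₀) :
    AnalyticOnNhd ℝ (sliceExt m D f₀) (axialDomain m D) ∧
    IsSliceMonogenicOn (axialDomain m D) (sliceExt m D f₀) ∧
    IsAxialMonogenic D (laplacePow n (sliceExt m D f₀)) ∧
    MemA D (fun x₀ => gammaConst m • iteratedDeriv (2 * n) f₀ x₀) ∧
    GCKWellDefined m D (fun x₀ => gammaConst m • iteratedDeriv (2 * n) f₀ x₀) ∧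
    ∀ x ∈ axialDomain m D, laplacePow n (sliceExt m D f₀) x
      = GCK m D (fun x₀ => gammaConst m • iteratedDeriv (2 * n) f₀ x₀) x := by
  obtain ⟨k, h, c, hrep⟩ := id hf₀
  obtain ⟨A, B, hv, hsum, hax⟩ := exists_axialFn_of_isHolRep hD hrep
  have hF : Set.EqOn (sliceExt m D f₀) (axialFn A B) (axialDomain m D) := fun x hx => by
    rw [sliceExt_eq hD hrep hx, hsum x hx]
  obtain ⟨hL, hL0⟩ := laplacePow_fueterSce hD.1 hm hv hF
  obtain ⟨hW, hE⟩ := gckWellDefined_of_axialMonogenic (by omega) hD hL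
    -- Here the constant stays inside the data, so only the restrictions have to match; they do by
    -- `gammaConst_mul`.
    (g := fun x₀ => gammaConst m • iteratedDeriv (2 * n) f₀ x₀) fun x₀ hx₀ => by
      have := VekuaAt.iteratedDeriv_axis (A := A) (B := B) (isOpen_realTrace hD.1)
        (fun u hu => by simpa using hv (u : ℂ) hu) hax n x₀ hx₀
      simp only [this]
      rw [hL0 x₀ hx₀, smul_smul, gammaConst_mul hm]
  exact ⟨analyticOnNhd_of_vekuaAt hD.1 hv hF, isSliceMonogenicOn_of_vekuaAt hD hv hF, hL,
    (hf₀.iteratedDeriv hD.1 _).const_smul _, hW, fun x hx => hE hx⟩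

end FueterGCK

end

theorem theorem4p2 (m : ℕ) (hm : Odd m) (D : Set ℂ) (hD : FueterGCK.IsIntrinsicDomain D) :
    -- the two formulas, for an intrinsic holomorphic function `f = α + iβ`
    (∀ f : ℂ → ℂ, FueterGCK.IsIntrinsicHol D f →
      (∀ x₀ ∈ FueterGCK.realTrace D,
        Filter.Tendsto
          (FueterGCK.radialOp ((m - 1) / 2) (FueterGCK.alphaPart f x₀))
          (nhdsWithin (0 : ℝ) {0}ᶜ)
          (nhds (FueterGCK.radialAtZero ((m - 1) / 2) f x₀))) ∧
      AnalyticOnNhd ℝ (FueterGCK.sliceExtC m f) (FueterGCK.axialDomain m D) ∧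
      FueterGCK.GCKWellDefined m D
        (fun x₀ => algebraMap ℝ (FueterGCK.Cl m)
          (FueterGCK.radialAtZero ((m - 1) / 2) f x₀)) ∧
      FueterGCK.GCKWellDefined m D
        (fun x₀ => algebraMap ℝ (FueterGCK.Cl m)
          (iteratedDeriv (m - 1) (fun t : ℝ => FueterGCK.alphaPart f t 0) x₀)) ∧
      ∀ x ∈ FueterGCK.axialDomain m D,
        FueterGCK.laplacePow ((m - 1) / 2) (FueterGCK.sliceExtC m f) x
          = (Nat.doubleFactorial (m - 1) : ℝ) •
            FueterGCK.GCK m D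
              (fun x₀ => algebraMap ℝ (FueterGCK.Cl m)
                (FueterGCK.radialAtZero ((m - 1) / 2) f x₀)) x ∧
        FueterGCK.laplacePow ((m - 1) / 2) (FueterGCK.sliceExtC m f) x
          = FueterGCK.gammaConst m •
            FueterGCK.GCK m D
              (fun x₀ => algebraMap ℝ (FueterGCK.Cl m)
                (iteratedDeriv (m - 1) (fun t : ℝ => FueterGCK.alphaPart f t 0) x₀)) x) ∧
    -- the commutative diagram `Δ^{(m-1)/2} ∘ S = GCK ∘ (γ_m ∂_{x_0}^{m-1})`
    (∀ f₀ : ℝ → FueterGCK.Cl m, FueterGCK.MemA D f₀ →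
      (∀ (n : ℕ) (h : Fin n → ℂ → ℂ) (c : Fin n → FueterGCK.Cl m),
        FueterGCK.IsHolRep D h c f₀ →
        ∀ x ∈ FueterGCK.axialDomain m D,
          FueterGCK.sliceExt m D f₀ x = ∑ i, FueterGCK.sliceExtC m (h i) x * c i) ∧
      AnalyticOnNhd ℝ (FueterGCK.sliceExt m D f₀) (FueterGCK.axialDomain m D) ∧
      FueterGCK.IsSliceMonogenicOn (FueterGCK.axialDomain m D) (FueterGCK.sliceExt m D f₀) ∧
      FueterGCK.IsAxialMonogenic D
        (FueterGCK.laplacePow ((m - 1) / 2) (FueterGCK.sliceExt m D f₀)) ∧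
      FueterGCK.MemA D (fun x₀ => FueterGCK.gammaConst m • iteratedDeriv (m - 1) f₀ x₀) ∧
      FueterGCK.GCKWellDefined m D
        (fun x₀ => FueterGCK.gammaConst m • iteratedDeriv (m - 1) f₀ x₀) ∧
      ∀ x ∈ FueterGCK.axialDomain m D,
        FueterGCK.laplacePow ((m - 1) / 2) (FueterGCK.sliceExt m D f₀) x
          = FueterGCK.GCK m D
              (fun x₀ => FueterGCK.gammaConst m • iteratedDeriv (m - 1) f₀ x₀) x) := by
  obtain ⟨n, hn⟩ := hm
  have h1 : m - 1 = 2 * n := by omega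
  have h2 : (m - 1) / 2 = n := by omega
  rw [h2, h1]
  refine ⟨fun f hf => ?_, fun f₀ hf₀ => ?_⟩
  · obtain ⟨a, b, ⟨c, d⟩, e, g⟩ := FueterGCK.fueterSce_gck_intrinsic hn hD hf
    exact ⟨a, b, c, e, fun x hx => ⟨d x hx, g x hx⟩⟩
  · exact ⟨fun _ _ _ hrep x hx => FueterGCK.sliceExt_eq hD hrep hx,
      FueterGCK.fueterSce_gck_slice hn hD hf₀⟩
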